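/- **Setting.** Let $G=(V,E)$ be a finite simple graph with edge weights $w(e)\ge 0$, and let $\mathcal M$ be a matroid on the ground set $V$, of rank $k$. For $S\subseteq V$ let $E_G(S)$ be the total weight of the edges that have at least one endpoint in $S$. A $(1-\varepsilon)$-approximate solution (of the matroid-constrained maximum vertex cover problem) is an independent set $S$ of $\mathcal M$ with $E_G(S)\ge(1-\varepsilon)\,E_G(T)$ for every independent set $T$ of $\mathcal M$. The matroid is *uniform* if its independent sets are the sets of at most $m$ elements, for some $m$; it is a *partition* (respectively *laminar*) matroid if there are a partition (respectively a family of pairwise disjoint or nested subsets) $V_1,\dots,V_r$ of $V$ and bounds $b_1,\dots,b_r\in\mathbb N$ such that $S$ is independent if and only if $|S\cap V_i|\le b_i$ for all $i$; it is *transversal* if there are sets $V_1,\dots,V_r\subseteq V$ such that $S$ is independent if and only if there is an injective map $\phi:S\to\{1,\dots,r\}$ with $u\in V_{\phi(u)}$ for all $u\in S$. In the *incidence* (adjacency-list) *streaming model* the vertices are taken in an arbitrary order, and for each vertex $v$ all edges incident to $v$ are given in a row, in arbitrary order, each as a triple $(v,u,w(\{v,u\}))$; so every edge appears exactly twice. A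 one-pass algorithm reads this stream once, from left to right. Its whole memory consists of *variables*: vertex variables (empty, or holding one vertex), weight variables (holding one real number), and index variables (holding an integer in $\{0,\dots,s\}$, where $s$ is the number of variables of each kind; the program counter is part of these). The next instruction is determined by the index variables through a fixed table, which does not depend on $V$, $G$, $w$, $\mathcal M$ or the stream. Vertices can only be read, erased, copied and tested for equality, weights only be read, set to zero, copied, added, subtracted and compared, and the matroid is accessed only by asking an oracle whether a set of currently stored vertices is independent. The algorithm finally outputs a set of stored vertices. **Theorem.** There is an absolute constant $C>0$ such that for every integer $k\ge 0$ and every $\varepsilon>0$: 1. there is a one-pass algorithm with at most $C\left(\frac{k}{\varepsilon}\right)^2$ variables that, for every finite weighted graph $G$, every uniform, partition or laminar matroid $\mathcal M$ of rank $k$ on its vertex set, and every incidence stream of $G$, stops and outputs a $(1-\varepsilon)$-approximate solution; 2. there is a one-pass algorithm with at most $C\left(\frac{k}{\varepsilon}+k\right)^2$ variables that does the same for every transversal matroid $\mathcal M$ of rank $k$. -/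

import Mathlib

namespace MVC

/-! ### The matroid-constrained maximum vertex cover problem -/

open Classical in
/-- `E_G(S)`: the total weight of the edges of `G` with at least one endpoint in `S`. -/
noncomputable def coverWeight {V : Type*} [Fintype V] (G : SimpleGraph V) (w : Sym2 V → ℝ)
    (S : Set V) : ℝ :=
  ∑ e : Sym2 V, if e ∈ G.edgeSet ∧ (∃ v ∈ S, v ∈ e) then w e else 0

/-- `S` is a `(1 - ε)`-approximate solution: it is independent in `M`, and the weight it covers is
at least `(1 - ε)` times the weight covered by any independent set. -/
def IsApproxSolution {V : Type*} [Fintype V] (G : SimpleGraph V) (w : Sym2 V → ℝ)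
    (M : Matroid V) (ε : ℝ) (S : Set V) : Prop :=
  M.Indep S ∧ ∀ T : Set V, M.Indep T → (1 - ε) * coverWeight G w T ≤ coverWeight G w S

/-! ### The four types of matroids (on a finite ground set `V`) -/

/-- The independent sets are the sets of at most `m` elements, for some `m`. -/
def IsUniform {V : Type*} (M : Matroid V) : Prop :=
  ∃ m : ℕ, ∀ S : Finset V, M.Indep (S : Set V) ↔ S.card ≤ m

/-- A partition of the ground set into `P 0, …, P (r - 1)`, with bounds `b i`. -/
def IsPartition {V : Type*} [DecidableEq V] (M : Matroid V) : Prop :=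
  ∃ (r : ℕ) (P : Fin r → Finset V) (b : Fin r → ℕ),
    (∀ i j, i ≠ j → Disjoint (P i) (P j)) ∧ (∀ v, ∃ i, v ∈ P i) ∧
    ∀ S : Finset V, M.Indep (S : Set V) ↔ ∀ i, (S ∩ P i).card ≤ b i

/-- A laminar family `F 0, …, F (r - 1)` (any two members are disjoint or nested), with
bounds `b i`. -/
def IsLaminar {V : Type*} [DecidableEq V] (M : Matroid V) : Prop :=
  ∃ (r : ℕ) (F : Fin r → Finset V) (b : Fin r → ℕ),
    (∀ i j, Disjoint (F i) (F j) ∨ F i ⊆ F j ∨ F j ⊆ F i) ∧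
    ∀ S : Finset V, M.Indep (S : Set V) ↔ ∀ i, (S ∩ F i).card ≤ b i

/-- The independent sets are the partial transversals of a family `A 0, …, A (r - 1)` of subsets
of the ground set, which need not be disjoint. -/
def IsTransversal {V : Type*} (M : Matroid V) : Prop :=
  ∃ (r : ℕ) (A : Fin r → Finset V),
    ∀ S : Finset V, M.Indep (S : Set V) ↔
      ∃ φ : {u // u ∈ S} → Fin r, Function.Injective φ ∧ ∀ u, u.1 ∈ A (φ u)

/-! ### The incidence (adjacency-list) stream -/

/-- `l` is an incidence stream of the weighted graph: for some ordering `order` of the vertices,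
and some ordering `nbrs v` of the neighbours of each vertex `v`, it lists, vertex after vertex, the
edges at this vertex in a row, each with its weight. Every edge appears exactly twice, once for
each endpoint; isolated vertices do not appear. -/
def IsIncidenceStream {V : Type*} (G : SimpleGraph V) (w : Sym2 V → ℝ)
    (l : List (V × V × ℝ)) : Prop :=
  ∃ (order : List V) (nbrs : V → List V),
    (order.Nodup ∧ ∀ v, v ∈ order) ∧
    (∀ v, (nbrs v).Nodup ∧ ∀ u, u ∈ nbrs v ↔ G.Adj v u) ∧
    l = order.flatMap fun v => (nbrs v).map fun u => (v, u, w s(v, u))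

/-! ### One-pass streaming algorithms with a bounded number of variables

The memory consists of `s` vertex variables (each is empty or holds one vertex), `s` weight
variables (each holds one real number) and `s` index variables (each holds a number in
`{0, …, s}`), and of nothing else. The program is a table that depends on no input: it says, for
each content of the index variables (which includes the program counter), which instruction comes
next. Vertices can only be copied, tested for equality and passed to the independence oracle of
the matroid; weights can only be copied, added, subtracted and compared. The stream can only be
read forward, one item at a time. -/

/-- The content of the index variables. -/
abbrev Ctrl (s : ℕ) : Type := Fin s → Fin (s + 1)

/-- The instructions. The last arguments, of type `Ctrl s`, are the new content of the index
variables, for each possible outcome of the instruction. -/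
inductive Instr (s : ℕ) : Type
  /-- Read the next edge `(v, u, x)` of the stream: `v` and `u` go to the vertex variables `i` and
  `j`, the weight `x` goes to the weight variable `a`. If the stream is over, go to `eos`. -/
  | read (i j a : Fin s) (next eos : Ctrl s)
  /-- Empty the vertex variable `i`. -/
  | clearV (i : Fin s) (next : Ctrl s)
  /-- Copy the vertex variable `j` to the vertex variable `i`. -/
  | copyV (i j : Fin s) (next : Ctrl s)
  /-- Do the vertex variables `i` and `j` have the same content? -/
  | eqV (i j : Fin s) (yes no : Ctrl s)
  /-- Oracle call: is the set of the vertices in the vertex variables `A` independent? -/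
  | indep (A : Finset (Fin s)) (yes no : Ctrl s)
  /-- Set the weight variable `a` to zero. -/
  | zeroW (a : Fin s) (next : Ctrl s)
  /-- Copy the weight variable `b` to the weight variable `a`. -/
  | copyW (a b : Fin s) (next : Ctrl s)
  /-- Add the weight variable `b` to the weight variable `a`. -/
  | addW (a b : Fin s) (next : Ctrl s)
  /-- Subtract the weight variable `b` from the weight variable `a`. -/
  | subW (a b : Fin s) (next : Ctrl s)
  /-- Is the weight variable `a` at most the weight variable `b`? -/
  | leW (a b : Fin s) (yes no : Ctrl s)
  /-- Stop, and output the set of the vertices in the vertex variables `A`. -/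
  | output (A : Finset (Fin s))

/-- A streaming algorithm with `s` variables of each of the three kinds. -/
structure StreamAlg (s : ℕ) : Type where
  /-- The initial content of the index variables. -/
  start : Ctrl s
  /-- The program. -/
  prog : Ctrl s → Instr s

/-- The number of variables of a streaming algorithm: vertex, weight and index variables. -/
def StreamAlg.numVars {s : ℕ} (_ : StreamAlg s) : ℕ := s + s + s

/-- A configuration: the memory, and the part of the stream that has not been read yet. -/
structure Config (V : Type*) (s : ℕ) where
  /-- The vertex variables. -/
  vtx : Fin s → Option V
  /-- The weight variables. -/
  wt : Fin s → ℝ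
  /-- The index variables. -/
  idx : Ctrl s
  /-- The unread part of the stream. -/
  unread : List (V × V × ℝ)

/-- The set of the vertices in the vertex variables `A`. -/
def Config.stored {V : Type*} {s : ℕ} (c : Config V s) (A : Finset (Fin s)) : Set V :=
  {v | ∃ i ∈ A, c.vtx i = some v}

/-- At the start, the vertex variables are empty and the weight variables are zero. -/
def StreamAlg.init {V : Type*} {s : ℕ} (P : StreamAlg s) (l : List (V × V × ℝ)) : Config V s where
  vtx := fun _ => none
  wt := fun _ => 0
  idx := P.start
  unread := l

open Classical in
/-- One step of the execution, with oracle access to the matroid `M`. -/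
noncomputable def StreamAlg.step {V : Type*} {s : ℕ} (P : StreamAlg s) (M : Matroid V)
    (c : Config V s) : Config V s :=
  match P.prog c.idx with
  | .read i j a next eos =>
    match c.unread with
    | [] => { c with idx := eos }
    | (v, u, x) :: rest =>
      { vtx := Function.update (Function.update c.vtx i (some v)) j (some u)
        wt := Function.update c.wt a x
        idx := next
        unread := rest }
  | .clearV i next => { c with vtx := Function.update c.vtx i none, idx := next }
  | .copyV i j next => { c with vtx := Function.update c.vtx i (c.vtx j), idx := next }
  | .eqV i j yes no => { c with idx := if c.vtx i = c.vtx j then yes else no }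
  | .indep A yes no => { c with idx := if M.Indep (c.stored A) then yes else no }
  | .zeroW a next => { c with wt := Function.update c.wt a 0, idx := next }
  | .copyW a b next => { c with wt := Function.update c.wt a (c.wt b), idx := next }
  | .addW a b next => { c with wt := Function.update c.wt a (c.wt a + c.wt b), idx := next }
  | .subW a b next => { c with wt := Function.update c.wt a (c.wt a - c.wt b), idx := next }
  | .leW a b yes no => { c with idx := if c.wt a ≤ c.wt b then yes else no }
  | .output _ => c

/-- On the stream `l`, with oracle access to `M`, the algorithm `P` stops after finitely many
steps and outputs `S`. -/
def StreamAlg.Outputs {V : Type*} {s : ℕ} (P : StreamAlg s) (M : Matroid V)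
    (l : List (V × V × ℝ)) (S : Set V) : Prop :=
  ∃ n : ℕ, ∃ A : Finset (Fin s),
    P.prog ((P.step M)^[n] (P.init l)).idx = .output A ∧
    ((P.step M)^[n] (P.init l)).stored A = S

end MVC

namespace MVC

-- Let M be any matroid of rank k, and τ = ⌈2/ε⌉. The algorithm keeps a kernel of τ levels, each an
-- independent set stored in k slots, together with the weighted degrees of its vertices and the
-- weights between them. A vertex whose edges have all been read passes through the levels one after
-- another. In each it is exchanged for a vertex of smaller degree (an empty slot counts as degree
-- 0) whenever the level stays independent, and whatever is displaced moves on. As for the greedy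
-- algorithm, every vertex of positive degree left outside is then spanned, in each level, by
-- vertices of at least its own degree (`Pass.mem_closure`, `Pass.spans`). Since a vertex arrives
-- with all its edges, its degree and its weights to the kernel are known before it is inserted.
-- This takes O((τk)²) registers. At the end all sets of slots are tried. This search is unrolled
-- into code of exponential length, whose program counter still fits into the index variables
-- (`exists_layout`).
--
-- The kernel suffices by `cov2_le_of_forall_mem_closure`. Let O be independent, A the part of its
-- positive-degree vertices inside the kernel and Q the part outside. In each level t, Q can be
-- replaced by a set X_t of at least the same total degree with A ∪ X_t independent
-- (`exists_replacement`). Let T be a best independent set with A ⊆ T inside the kernel. By local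
-- optimality and a matching argument (`sum_le_sum_of_forall_exchange`), the edges from X_t to the
-- complement of T weigh at most those from T \ A to it, summed over vertices. The X_t are disjoint,
-- so their edges to T weigh at most the degree sum of T for all t together; averaged over t, only a
-- fraction of order 1/τ is lost. This gives τ·E(O) ≤ (τ + 2)·E(T), and τε ≥ 2 turns it into the
-- factor 1 - ε.

universe u

/-! ### Straight-line programs with forward jumps -/

/-- A memory with vertex registers `α` and weight registers `β`. -/
structure Mem (V : Type u) (α β : Type) where
  vtx : α → Option V
  wt : β → ℝ

/-- The instructions that change the memory. -/
inductive Op (α β : Type) : Type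
  | clearV (i : α)
  | copyV (i j : α)
  | zeroW (a : β)
  | copyW (a b : β)
  | addW (a b : β)
  | subW (a b : β)

/-- The tests. -/
inductive Query (α β : Type) : Type
  | eqV (i j : α)
  | indep (A : Finset α)
  | leW (a b : β)

/-- A command: an operation, or a guard, which skips the next `n` commands unless the answer to
the query is `b`. -/
inductive Cmd (α β : Type) : Type
  | op (o : Op α β)
  | guard (t : Query α β) (b : Bool) (n : ℕ)

variable {V : Type u} {α β : Type}

/-- The set of the vertices in the registers `A`. -/
def Mem.stored (m : Mem V α β) (A : Finset α) : Set V := {v | ∃ i ∈ A, m.vtx i = some v}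

/-- The effect of an operation. -/
noncomputable def Op.apply [DecidableEq α] [DecidableEq β] : Op α β → Mem V α β → Mem V α β
  | .clearV i, m => { m with vtx := Function.update m.vtx i none }
  | .copyV i j, m => { m with vtx := Function.update m.vtx i (m.vtx j) }
  | .zeroW a, m => { m with wt := Function.update m.wt a 0 }
  | .copyW a b, m => { m with wt := Function.update m.wt a (m.wt b) }
  | .addW a b, m => { m with wt := Function.update m.wt a (m.wt a + m.wt b) }
  | .subW a b, m => { m with wt := Function.update m.wt a (m.wt a - m.wt b) }

/-- The answer to a query. -/
def Query.Holds (M : Matroid V) : Query α β → Mem V α β → Prop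
  | .eqV i j, m => m.vtx i = m.vtx j
  | .indep A, m => M.Indep (m.stored A)
  | .leW a b, m => m.wt a ≤ m.wt b

open Classical in
/-- One step: the remaining commands, and the memory. -/
noncomputable def nextCmd [DecidableEq α] [DecidableEq β] (M : Matroid V) :
    List (Cmd α β) × Mem V α β → List (Cmd α β) × Mem V α β
  | ([], m) => ([], m)
  | (.op o :: rest, m) => (rest, o.apply m)
  | (.guard t b n :: rest, m) => (if t.Holds M m ↔ b = true then rest else rest.drop n, m)

/-- Executing `code` transforms the memory by `f`. -/
def Computes [DecidableEq α] [DecidableEq β] (M : Matroid V) (code : List (Cmd α β))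
    (f : Mem V α β → Mem V α β) : Prop :=
  ∀ rest m, ∃ n, (nextCmd M)^[n] (code ++ rest, m) = (rest, f m)

/-- Execute `code` if the answer to `t` is `b`. -/
def whenCode (t : Query α β) (b : Bool) (code : List (Cmd α β)) : List (Cmd α β) :=
  .guard t b code.length :: code

section Computes

variable [DecidableEq α] [DecidableEq β] {M : Matroid V}

theorem Computes.nil : Computes M ([] : List (Cmd α β)) id := fun _ _ => ⟨0, rfl⟩

theorem Computes.op (o : Op α β) : Computes M [.op o] o.apply := fun _ _ => ⟨1, rfl⟩

theorem Computes.append {c d : List (Cmd α β)} {f g : Mem V α β → Mem V α β}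
    (hc : Computes M c f) (hd : Computes M d g) : Computes M (c ++ d) (fun m => g (f m)) := by
  intro rest m
  obtain ⟨n, hn⟩ := hc (d ++ rest) m
  obtain ⟨n', hn'⟩ := hd rest (f m)
  exact ⟨n' + n, by rw [Function.iterate_add_apply, List.append_assoc, hn, hn']⟩

theorem Computes.flatMap {ι : Type} {c : ι → List (Cmd α β)}
    {f : ι → Mem V α β → Mem V α β} (h : ∀ i, Computes M (c i) (f i)) (l : List ι) :
    Computes M (l.flatMap c) (fun m => l.foldl (fun m i => f i m) m) := by
  induction l with
  | nil => exact Computes.nil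
  | cons i l ih => exact (h i).append ih

open Classical in
theorem Computes.when (t : Query α β) (b : Bool) {c : List (Cmd α β)}
    {f : Mem V α β → Mem V α β} (h : Computes M c f) :
    Computes M (whenCode t b c) (fun m => if t.Holds M m ↔ b = true then f m else m) := by
  intro rest m
  by_cases ht : t.Holds M m ↔ b = true
  · obtain ⟨n, hn⟩ := h rest m
    refine ⟨n + 1, ?_⟩
    simp only [Function.iterate_succ_apply, if_pos ht]
    rw [← hn]
    simp [whenCode, nextCmd, ht]
  · refine ⟨1, ?_⟩
    simp only [if_neg ht]
    simp [whenCode, nextCmd, ht]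

open Classical in
theorem Computes.whenTrue (t : Query α β) {c : List (Cmd α β)} {f : Mem V α β → Mem V α β}
    (h : Computes M c f) :
    Computes M (whenCode t true c) (fun m => if t.Holds M m then f m else m) := by
  simpa using h.when t true

open Classical in
theorem Computes.whenFalse (t : Query α β) {c : List (Cmd α β)} {f : Mem V α β → Mem V α β}
    (h : Computes M c f) :
    Computes M (whenCode t false c) (fun m => if ¬ t.Holds M m then f m else m) := by
  simpa using h.when t false

end Computes

/-! ### Translation to streaming algorithms -/

/-- How registers and program counters are stored in the variables of a streaming algorithm. -/
structure Layout (α β : Type) (s L : ℕ) where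
  vreg : α ↪ Fin s
  wreg : β ↪ Fin s
  enc : Bool → ℕ → Ctrl s
  dec : Ctrl s → Bool × ℕ
  dec_enc : ∀ b n, n ≤ L → dec (enc b n) = (b, n)

/-- The s index variables have (s + 1)^s joint contents, and each pair of a phase and a counter
needs one of its own. So the length of the code may be exponential in s. -/
theorem exists_layout [Fintype α] [Fintype β] {s L : ℕ} (hα : Fintype.card α ≤ s)
    (hβ : Fintype.card β ≤ s) (hL : 2 * (L + 1) ≤ (s + 1) ^ s) : Nonempty (Layout α β s L) := by
  obtain ⟨f⟩ : Nonempty (α ↪ Fin s) :=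
    Function.Embedding.nonempty_of_card_le (by simpa using hα)
  obtain ⟨g⟩ : Nonempty (β ↪ Fin s) :=
    Function.Embedding.nonempty_of_card_le (by simpa using hβ)
  obtain ⟨e⟩ : Nonempty (Bool × Fin (L + 1) ↪ Ctrl s) :=
    Function.Embedding.nonempty_of_card_le (by simpa using hL)
  refine ⟨⟨f, g, fun b n => e (b, Fin.ofNat (L + 1) n), fun c =>
    let q := Function.invFun e c
    (q.1, q.2), fun b n hn => ?_⟩⟩
  simp only [Function.leftInverse_invFun e.injective _]
  simp [Nat.mod_eq_of_lt (Nat.lt_succ_of_le hn)]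

variable {s L : ℕ}

/-- The instruction for an operation. -/
def Op.instr (lay : Layout α β s L) (next : Ctrl s) : Op α β → Instr s
  | .clearV i => .clearV (lay.vreg i) next
  | .copyV i j => .copyV (lay.vreg i) (lay.vreg j) next
  | .zeroW a => .zeroW (lay.wreg a) next
  | .copyW a b => .copyW (lay.wreg a) (lay.wreg b) next
  | .addW a b => .addW (lay.wreg a) (lay.wreg b) next
  | .subW a b => .subW (lay.wreg a) (lay.wreg b) next

/-- The instruction for a query. -/
def Query.instr (lay : Layout α β s L) (yes no : Ctrl s) : Query α β → Instr s
  | .eqV i j => .eqV (lay.vreg i) (lay.vreg j) yes no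
  | .indep A => .indep (A.map lay.vreg) yes no
  | .leW a b => .leW (lay.wreg a) (lay.wreg b) yes no

/-- The instruction for a command that is followed by `rest`. -/
def Cmd.instr (lay : Layout α β s L) (ph : Bool) (rest : List (Cmd α β)) : Cmd α β → Instr s
  | .op o => o.instr lay (lay.enc ph rest.length)
  | .guard t true n => t.instr lay (lay.enc ph rest.length) (lay.enc ph (rest.drop n).length)
  | .guard t false n => t.instr lay (lay.enc ph (rest.drop n).length) (lay.enc ph rest.length)

/-- A one-pass program: `body` is executed for each item of the stream, `final` at its end. -/
structure Program (α β : Type) where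
  body : List (Cmd α β)
  final : List (Cmd α β)
  inV : α
  inU : α
  inX : β
  out : Finset α

/-- The code of the two phases. -/
def Program.code (p : Program α β) : Bool → List (Cmd α β)
  | false => p.body
  | true => p.final

/-- The streaming algorithm for a one-pass program. -/
def Program.alg (p : Program α β) (lay : Layout α β s L) : StreamAlg s where
  start := lay.enc false 0
  prog c :=
    -- The counter is the number of commands still to be executed. As jumps only go forward, these
    -- always form a suffix of the code.
    match (p.code (lay.dec c).1).drop ((p.code (lay.dec c).1).length - (lay.dec c).2) with
    | [] => if (lay.dec c).1 then .output (p.out.map lay.vreg) else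
        .read (lay.vreg p.inV) (lay.vreg p.inU) (lay.wreg p.inX)
          (lay.enc false p.body.length) (lay.enc true p.final.length)
    | c' :: rest => c'.instr lay (lay.dec c).1 rest

/-- The configuration `c` is in phase `ph`, with remaining commands and memory `x`. -/
structure Program.Sim (p : Program α β) (lay : Layout α β s L) (ph : Bool)
    (x : List (Cmd α β) × Mem V α β) (l : List (V × V × ℝ)) (c : Config V s) : Prop where
  idx : c.idx = lay.enc ph x.1.length
  suffix : x.1 <:+ p.code ph
  vtx : ∀ i, c.vtx (lay.vreg i) = x.2.vtx i
  wt : ∀ a, c.wt (lay.wreg a) = x.2.wt a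
  unread : c.unread = l

section Sim

variable {p : Program α β} {lay : Layout α β s L}

theorem Program.Sim.stored {ph : Bool} {x : List (Cmd α β) × Mem V α β}
    {l : List (V × V × ℝ)} {c : Config V s} (h : p.Sim lay ph x l c) (A : Finset α) :
    c.stored (A.map lay.vreg) = x.2.stored A := by
  ext v
  simp [Config.stored, Mem.stored, h.vtx]

theorem Program.Sim.prog_eq {ph : Bool} {x : List (Cmd α β) × Mem V α β}
    {l : List (V × V × ℝ)} {c : Config V s} (hL : ∀ ph, (p.code ph).length ≤ L)
    (h : p.Sim lay ph x l c) : (p.alg lay).prog c.idx =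
      match x.1 with
      | [] => if ph then .output (p.out.map lay.vreg) else
          .read (lay.vreg p.inV) (lay.vreg p.inU) (lay.wreg p.inX)
            (lay.enc false p.body.length) (lay.enc true p.final.length)
      | c' :: rest => c'.instr lay ph rest := by
  have hd : lay.dec c.idx = (ph, x.1.length) := by
    rw [h.idx, lay.dec_enc _ _ (h.suffix.length_le.trans (hL ph))]
  simp only [Program.alg, hd, ← List.suffix_iff_eq_drop.1 h.suffix]

theorem Program.Sim.readEnd {M : Matroid V} (hL : ∀ ph, (p.code ph).length ≤ L)
    {m : Mem V α β} {c : Config V s} (h : p.Sim lay false ([], m) [] c) :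
    p.Sim lay true (p.final, m) [] ((p.alg lay).step M c) := by
  have hp := h.prog_eq hL
  obtain ⟨hi, hs, hv, hw, hu⟩ := h
  simp only [Bool.false_eq_true, if_false] at hp
  simp only [StreamAlg.step, hp, hu]
  constructor <;> simp_all [Program.code]

variable [DecidableEq α] [DecidableEq β]

theorem Program.Sim.next {M : Matroid V} {ph : Bool} {x : List (Cmd α β) × Mem V α β}
    {l : List (V × V × ℝ)} {c : Config V s} (hL : ∀ ph, (p.code ph).length ≤ L)
    (h : p.Sim lay ph x l c) (hx : x.1 ≠ []) :
    p.Sim lay ph (nextCmd M x) l ((p.alg lay).step M c) := by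
  have hp := h.prog_eq hL
  have hst := h.stored
  obtain ⟨code, m⟩ := x
  obtain ⟨hi, hs, hv, hw, hu⟩ := h
  rcases code with - | ⟨c', rest⟩
  · exact absurd rfl hx
  have hs' : rest <:+ p.code ph := (List.suffix_cons _ _).trans hs
  have hite (n : ℕ) (q : Prop) {_ : Decidable q} :
      (if q then rest else rest.drop n) <:+ p.code ph := by
    split_ifs
    exacts [hs', (List.drop_suffix _ _).trans hs']
  simp only at hp hv hw hst
  rcases c' with o | ⟨t, b, n⟩
  · rcases o with i | ⟨i, j⟩ | a | ⟨a, b⟩ | ⟨a, b⟩ | ⟨a, b⟩ <;>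
    · simp only [StreamAlg.step, hp, Cmd.instr, Op.instr, nextCmd, Op.apply]
      constructor <;>
        simp [hs', hv, hw, hu, Function.update_apply]
  · rcases b with - | - <;> rcases t with ⟨i, j⟩ | A | ⟨a, b⟩ <;>
    · simp only [StreamAlg.step, hp, Cmd.instr, Query.instr, nextCmd, Query.Holds]
      constructor
      · simp only [hv, hw, hst]
        split_ifs <;> simp_all
      · exact hite n _
      · exact hv
      · exact hw
      · exact hu

theorem Program.Sim.iterate {M : Matroid V} (hL : ∀ ph, (p.code ph).length ≤ L) {ph : Bool}
    {l : List (V × V × ℝ)} (n : ℕ) {x : List (Cmd α β) × Mem V α β} {c : Config V s}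
    (h : p.Sim lay ph x l c) :
    ∃ n', p.Sim lay ph ((nextCmd M)^[n] x) l (((p.alg lay).step M)^[n'] c) := by
  induction n generalizing x c with
  | zero => exact ⟨0, h⟩
  | succ n ih =>
    -- `nextCmd` idles once the code is exhausted, whereas the machine would go on reading; such
    -- idle steps correspond to no machine step.
    by_cases hx : x.1 = []
    · have : nextCmd M x = x := by
        obtain ⟨code, m⟩ := x
        subst hx
        rfl
      rw [Function.iterate_succ_apply, this]
      exact ih h
    · obtain ⟨n', hn'⟩ := ih (h.next (M := M) hL hx)
      exact ⟨n' + 1, hn'⟩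

/-- The memory after an item has been read. -/
def Program.readItem (p : Program α β) (m : Mem V α β) (e : V × V × ℝ) : Mem V α β where
  vtx := Function.update (Function.update m.vtx p.inV (some e.1)) p.inU (some e.2.1)
  wt := Function.update m.wt p.inX e.2.2

theorem Program.Sim.read {M : Matroid V} (hL : ∀ ph, (p.code ph).length ≤ L)
    {e : V × V × ℝ} {l : List (V × V × ℝ)} {m : Mem V α β} {c : Config V s}
    (h : p.Sim lay false ([], m) (e :: l) c) :
    p.Sim lay false (p.body, p.readItem m e) l ((p.alg lay).step M c) := by
  have hp := h.prog_eq hL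
  obtain ⟨hi, hs, hv, hw, hu⟩ := h
  simp only [Bool.false_eq_true, if_false] at hp
  simp only [StreamAlg.step, hp, hu]
  constructor <;> simp_all [Program.readItem, Program.code, Function.update_apply]

/-- What the streaming algorithm for a one-pass program outputs. -/
theorem Program.outputs {M : Matroid V} (hL : ∀ ph, (p.code ph).length ≤ L)
    {f g : Mem V α β → Mem V α β} (hf : Computes M p.body f) (hg : Computes M p.final g)
    (l : List (V × V × ℝ)) :
    (p.alg lay).Outputs M l
      ((g (l.foldl (fun m e => f (p.readItem m e)) ⟨fun _ => none, fun _ => 0⟩)).stored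
        p.out) := by
  have key : ∀ (l : List (V × V × ℝ)) (m : Mem V α β) (c : Config V s),
      p.Sim lay false ([], m) l c → ∃ n, p.Sim lay true
        ([], g (l.foldl (fun m e => f (p.readItem m e)) m)) []
        (((p.alg lay).step M)^[n] c) := by
    intro l
    induction l with
    | nil =>
      intro m c h
      obtain ⟨n, hn⟩ := hg [] m
      obtain ⟨n', hn'⟩ := Program.Sim.iterate (M := M) hL n (h.readEnd (M := M) hL)
      rw [List.append_nil] at hn
      rw [hn] at hn'
      exact ⟨n' + 1, hn'⟩
    | cons e l ih =>
      intro m c h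
      obtain ⟨n, hn⟩ := hf [] (p.readItem m e)
      obtain ⟨n', hn'⟩ := Program.Sim.iterate (M := M) hL n (h.read (M := M) hL)
      rw [List.append_nil] at hn
      rw [hn] at hn'
      obtain ⟨k, hk⟩ := ih _ _ hn'
      refine ⟨k + (n' + 1), ?_⟩
      rw [Function.iterate_add_apply]
      exact hk
  obtain ⟨n, hn⟩ := key l ⟨fun _ => none, fun _ => 0⟩ ((p.alg lay).init l)
    ⟨rfl, List.nil_suffix, fun _ => rfl, fun _ => rfl, rfl⟩
  refine ⟨n, p.out.map lay.vreg, ?_, hn.stored p.out⟩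
  rw [hn.prog_eq hL]
  rfl

end Sim

/-! ### The approximation guarantee -/

section Approximation

variable {V : Type u} [Fintype V]

/-- The weighted degree of `v`. -/
def wdeg (a : V → V → ℝ) (v : V) : ℝ := ∑ u, a v u

/-- Twice the weight covered by `S`, for edge weights `a`. -/
def cov2 (a : V → V → ℝ) (S : Finset V) : ℝ :=
  2 * ∑ v ∈ S, wdeg a v - ∑ v ∈ S, ∑ u ∈ S, a v u

/-- The function `a` is symmetric, nonnegative, and zero on the diagonal. -/
structure IsWeight (a : V → V → ℝ) : Prop where
  symm : ∀ u v, a u v = a v u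
  nonneg : ∀ u v, 0 ≤ a u v
  diag : ∀ v, a v v = 0

/-- The weight of the edges between `v` and the complement of `S`. -/
def gain (a : V → V → ℝ) (S : Finset V) (v : V) : ℝ := wdeg a v - ∑ u ∈ S, a v u

variable {a : V → V → ℝ}

theorem IsWeight.wdeg_nonneg (ha : IsWeight a) (v : V) : 0 ≤ wdeg a v :=
  Finset.sum_nonneg fun u _ => ha.nonneg v u

theorem IsWeight.sum_le_wdeg (ha : IsWeight a) (S : Finset V) (v : V) :
    ∑ u ∈ S, a v u ≤ wdeg a v :=
  Finset.sum_le_univ_sum_of_nonneg (ha.nonneg v)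

theorem IsWeight.gain_nonneg (ha : IsWeight a) (S : Finset V) (v : V) : 0 ≤ gain a S v :=
  sub_nonneg.2 (ha.sum_le_wdeg S v)

theorem IsWeight.gain_le_wdeg (ha : IsWeight a) (S : Finset V) (v : V) : gain a S v ≤ wdeg a v :=
  sub_le_self _ (Finset.sum_nonneg fun u _ => ha.nonneg v u)

theorem IsWeight.gain_anti (ha : IsWeight a) {S T : Finset V} (h : S ⊆ T) (v : V) :
    gain a T v ≤ gain a S v :=
  sub_le_sub_left (Finset.sum_le_sum_of_subset_of_nonneg h fun u _ _ => ha.nonneg v u) _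

theorem IsWeight.sum_wdeg_le_cov2 (ha : IsWeight a) (S : Finset V) :
    ∑ v ∈ S, wdeg a v ≤ cov2 a S := by
  have : ∑ v ∈ S, ∑ u ∈ S, a v u ≤ ∑ v ∈ S, wdeg a v :=
    Finset.sum_le_sum fun v _ => ha.sum_le_wdeg S v
  unfold cov2
  linarith

variable [DecidableEq V]

theorem IsWeight.cov2_insert (ha : IsWeight a) {S : Finset V} {y : V} (hy : y ∉ S) :
    cov2 a (insert y S) = cov2 a S + 2 * gain a S y := by
  simp only [cov2, gain, Finset.sum_insert hy, ha.diag, Finset.sum_add_distrib]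
  have : ∑ x ∈ S, a x y = ∑ x ∈ S, a y x := Finset.sum_congr rfl fun x _ => ha.symm x y
  rw [this]
  ring

theorem IsWeight.cov2_union_le (ha : IsWeight a) (S T : Finset V) :
    cov2 a (S ∪ T) ≤ cov2 a S + 2 * ∑ v ∈ T, wdeg a v := by
  induction T using Finset.induction_on with
  | empty => simp
  | insert y T hy ih =>
    rw [Finset.sum_insert hy, Finset.union_insert]
    by_cases h : y ∈ S ∪ T
    · rw [Finset.insert_eq_of_mem h]
      linarith [ha.wdeg_nonneg y]
    · rw [ha.cov2_insert h]
      linarith [ha.gain_le_wdeg (S ∪ T) y]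

/-- Insert the elements of R one by one: each is added to a subset of S, where its gain is at least
its gain over S. -/
theorem IsWeight.sum_gain_le (ha : IsWeight a) {A S R : Finset V} (hS : A ∪ R ⊆ S)
    (hR : Disjoint A R) : cov2 a A + 2 * ∑ v ∈ R, gain a S v ≤ cov2 a (A ∪ R) := by
  induction R using Finset.induction_on with
  | empty => simp
  | insert y R hy ih =>
    rw [Finset.union_insert] at hS ⊢
    rw [Finset.disjoint_insert_right] at hR
    have hS' : A ∪ R ⊆ S := (Finset.subset_insert _ _).trans hS
    rw [Finset.sum_insert hy, ha.cov2_insert (by simp [hy, hR.1])]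
    linarith [ha.gain_anti hS' y, ih hS' hR.2]

/-- Removing x loses exactly its edges to the complement of S; afterwards y gains at least what it
would gain over the larger set S. -/
theorem IsWeight.cov2_exchange (ha : IsWeight a) {S : Finset V} {x y : V} (hx : x ∈ S)
    (hy : y ∉ S) :
    cov2 a S + 2 * gain a S y - 2 * gain a S x ≤ cov2 a (insert y (S.erase x)) := by
  have h1 := ha.cov2_insert (Finset.notMem_erase x S)
  rw [Finset.insert_erase hx] at h1
  have h2 : gain a (S.erase x) x = gain a S x := by
    simp only [gain, ← Finset.sum_erase_add S _ hx, ha.diag, add_zero]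
  rw [ha.cov2_insert (by simp [hy] : y ∉ S.erase x), h1, h2]
  linarith [ha.gain_anti (Finset.erase_subset x S) y]

end Approximation

/-! ### Exchange arguments in matroids, and the quality of the kernel -/

section Exchange

variable {V : Type u} [DecidableEq V] {M : Matroid V}

open Classical in
/-- If no exchange of an element of `S \ J` for an element of `J \ S` increases the weight `c`,
then `S` is at least as heavy as `J`. -/
theorem sum_le_sum_of_forall_exchange (hE : M.E = Set.univ) {S J : Finset V}
    (hS : M.Indep (S : Set V)) (hJ : M.Indep (J : Set V)) {c : V → ℝ}
    (h0 : ∀ x ∈ S, 0 ≤ c x)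
    (h1 : ∀ y ∈ J \ S, M.Indep (insert y (S : Set V)) → c y ≤ 0)
    (h2 : ∀ y ∈ J \ S, ∀ x ∈ S \ J, M.Indep ((insert y (S.erase x) : Finset V) : Set V) →
      c y ≤ c x) :
    ∑ y ∈ J, c y ≤ ∑ x ∈ S, c x := by
  -- Only these y have to be matched with lighter or equal partners' counterparts in S \ J: each y
  -- outside `Y` has weight at most 0 by `h1`.
  set Y := (J \ S).filter fun y => ¬ M.Indep (insert y (S : Set V)) with hY
  set N : Y → Finset V := fun y =>
    (S \ J).filter fun x => M.Indep ((insert y.1 (S.erase x) : Finset V) : Set V) with hN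
  -- Hall's condition. The candidates for y are the elements of its fundamental circuit in S that
  -- lie outside J.
  have hall : ∀ Z : Finset Y, Z.card ≤ (Z.biUnion N).card := by
    intro Z
    set Z' : Finset V := Z.map (Function.Embedding.subtype _) with hZ'
    have hZJ : Z' ⊆ J \ S := by
      intro y hy
      obtain ⟨⟨y', hy'⟩, -, rfl⟩ := Finset.mem_map.1 hy
      exact (Finset.mem_filter.1 hy').1
    -- Each y is spanned by the rest of its fundamental circuit, which consists of candidates and
    -- elements of J ∩ S.
    have hcl : ((Z' ∪ (J ∩ S) : Finset V) : Set V) ⊆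
        M.closure ((Z.biUnion N ∪ (J ∩ S) : Finset V) : Set V) := by
      intro y hy
      rw [Finset.mem_coe, Finset.mem_union] at hy
      rcases hy with hy | hy
      · obtain ⟨⟨y', hy'⟩, hyZ, rfl⟩ := Finset.mem_map.1 hy
        obtain ⟨hyJS, hydep⟩ := Finset.mem_filter.1 hy'
        have hyS : y' ∉ (S : Set V) := by simpa using (Finset.mem_sdiff.1 hyJS).2
        have hycl : y' ∈ M.closure S := by
          rw [hS.mem_closure_iff_of_notMem hyS, Matroid.dep_iff]
          exact ⟨hydep, by simp [hE]⟩
        have hC := hS.fundCircuit_isCircuit hycl hyS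
        refine M.closure_subset_closure ?_
          (hC.mem_closure_sdiff_singleton_of_mem (M.mem_fundCircuit y' S))
        intro x hx
        replace hx : x ∈ M.fundCircuit y' S \ {y'} := hx
        rw [M.fundCircuit_sdiff_eq_inter hyS] at hx
        have hxi := (hS.mem_fundCircuit_iff hycl hyS).1 hx.1
        have hxS : x ∈ S := hx.2
        rw [Finset.mem_coe, Finset.mem_union]
        by_cases hxJ : x ∈ J
        · exact .inr (Finset.mem_inter.2 ⟨hxJ, hxS⟩)
        · refine .inl (Finset.mem_biUnion.2 ⟨_, hyZ, Finset.mem_filter.2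
            ⟨Finset.mem_sdiff.2 ⟨hxS, hxJ⟩, ?_⟩⟩)
          have hne : y' ≠ x := by
            rintro rfl
            exact hyS hxS
          rwa [← Set.insert_sdiff_singleton_comm hne, ← Finset.coe_erase, ← Finset.coe_insert]
            at hxi
      · exact M.mem_closure_of_mem (by simpa using Or.inr hy) (by simp [hE])
    have hind : M.Indep ((Z' ∪ (J ∩ S) : Finset V) : Set V) :=
      hJ.subset (Finset.coe_subset.2 (Finset.union_subset
        (hZJ.trans Finset.sdiff_subset) Finset.inter_subset_left))
    -- The independent set on the left has at most as many elements as the set spanning it; J ∩ S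
    -- then cancels from both sides.
    have hle := (hind.encard_le_eRk_of_subset hcl).trans
      ((M.eRk_closure_eq _).trans_le (M.eRk_le_encard _))
    rw [Set.encard_coe_eq_coe_finsetCard, Set.encard_coe_eq_coe_finsetCard, Nat.cast_le,
      Finset.card_union_of_disjoint] at hle
    · have := Finset.card_union_le (Z.biUnion N) (J ∩ S)
      have hc : Z'.card = Z.card := Finset.card_map _
      omega
    · rw [Finset.disjoint_left]
      intro y hy hy'
      exact (Finset.mem_sdiff.1 (hZJ hy)).2 (Finset.mem_inter.1 hy').2
  obtain ⟨g, hginj, hg⟩ := (Finset.all_card_le_biUnion_card_iff_exists_injective N).1 hall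
  have hle1 : ∑ y ∈ J \ S, c y ≤ ∑ y ∈ Y, c y := by
    rw [hY, Finset.sum_filter]
    refine Finset.sum_le_sum fun y hy => ?_
    split_ifs with h
    · exact h1 y hy h
    · exact le_rfl
  have hle2 : ∑ y ∈ Y, c y ≤ ∑ y : Y, c (g y) := by
    rw [← Finset.sum_coe_sort Y c]
    refine Finset.sum_le_sum fun y _ => ?_
    obtain ⟨hx, hi⟩ := Finset.mem_filter.1 (hg y)
    exact h2 y (Finset.mem_filter.1 y.2).1 _ hx hi
  have hle3 : ∑ y : Y, c (g y) ≤ ∑ x ∈ S \ J, c x := by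
    rw [← Finset.sum_image (f := c) (s := Finset.univ) (g := g) fun x _ y _ h => hginj h]
    refine Finset.sum_le_sum_of_subset_of_nonneg ?_ fun x hx _ => h0 x (Finset.mem_sdiff.1 hx).1
    intro x hx
    obtain ⟨y, -, rfl⟩ := Finset.mem_image.1 hx
    exact (Finset.mem_filter.1 (hg y)).1
  have e1 := Finset.sum_inter_add_sum_sdiff J S c
  have e2 := Finset.sum_inter_add_sum_sdiff S J c
  rw [Finset.inter_comm] at e2
  linarith

/-- Elements `T` of an independent set that are spanned by elements of `B` of larger weight can be
replaced by such elements. -/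
theorem exists_replacement (hE : M.E = Set.univ) {O B : Finset V} (hO : M.Indep (O : Set V))
    {c : V → ℝ} (T : Finset V) (hTO : T ⊆ O)
    (hT : ∀ o ∈ T, o ∈ M.closure {y | y ∈ B ∧ c o ≤ c y}) :
    ∃ X ⊆ B, Disjoint (O \ T) X ∧ M.Indep ((O \ T ∪ X : Finset V) : Set V) ∧
      ∑ o ∈ T, c o ≤ ∑ x ∈ X, c x := by
  induction T using Finset.induction_on with
  | empty => exact ⟨∅, by simp, by simp, by simpa using hO, by simp⟩
  | insert o T hoT ih =>
    obtain ⟨X, hXB, hdisj, hind, hsum⟩ := ih ((Finset.subset_insert _ _).trans hTO)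
      fun o' ho' => hT o' (Finset.mem_insert_of_mem ho')
    have hoO : o ∈ O \ T := Finset.mem_sdiff.2 ⟨hTO (Finset.mem_insert_self _ _), hoT⟩
    have hoX : o ∉ X := Finset.disjoint_left.1 hdisj hoO
    set I := O \ insert o T ∪ X with hI
    have hoI : o ∉ I := by simp [hI, hoX]
    have hIo : insert o I = O \ T ∪ X := by
      ext x
      by_cases hx : x = o
      · subst hx; simpa using Or.inl (by simpa using hoO)
      · simp [hI, hx]
    rw [← hIo, Finset.coe_insert] at hind
    have hIind : M.Indep (I : Set V) := hind.subset (Set.subset_insert _ _)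
    have hocl : o ∉ M.closure I := by
      rw [hIind.notMem_closure_iff_of_notMem (by simpa using hoI) (by simp [hE])]
      exact hind
    -- The heavier elements of `B` span o, but `I` does not; so one of them is outside the closure
    -- of `I` and can take the place of o.
    obtain ⟨y, ⟨hyB, hyc⟩, hycl⟩ : ∃ y ∈ {y | y ∈ B ∧ c o ≤ c y}, y ∉ M.closure I := by
      by_contra! hcon
      exact hocl (M.closure_subset_closure_of_subset_closure hcon
        (hT o (Finset.mem_insert_self _ _)))
    rw [hIind.notMem_closure_iff (by simp [hE])] at hycl
    have hyI : y ∉ I := by simpa using hycl.2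
    rw [hI, Finset.mem_union, not_or] at hyI
    refine ⟨insert y X, Finset.insert_subset hyB hXB, ?_, ?_, ?_⟩
    · rw [Finset.disjoint_insert_right]
      exact ⟨hyI.1, hdisj.mono_left (Finset.sdiff_subset_sdiff le_rfl (Finset.subset_insert _ _))⟩
    · rw [Finset.union_insert, Finset.coe_insert]
      exact hycl.1
    · rw [Finset.sum_insert hoT, Finset.sum_insert hyI.2]
      linarith

open Classical in
/-- The best independent subset of `B 0 ∪ … ∪ B (τ - 1)` is almost as good as any independent set,
if each vertex outside is spanned by the vertices of larger degree in each of these sets. -/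
theorem cov2_le_of_forall_mem_closure [Fintype V] (hE : M.E = Set.univ) {a : V → V → ℝ} (ha : IsWeight a)
    {τ : ℕ} (hτ : 0 < τ) {B : Fin τ → Finset V} (hB : ∀ s t, s ≠ t → Disjoint (B s) (B t))
    (hspan : ∀ v, 0 < wdeg a v → (∀ t, v ∉ B t) →
      ∀ t, v ∈ M.closure {y | y ∈ B t ∧ wdeg a v ≤ wdeg a y})
    {S : Finset V} (hS : ∀ T ⊆ Finset.univ.biUnion B, M.Indep (T : Set V) → cov2 a T ≤ cov2 a S)
    {O : Finset V} (hO : M.Indep (O : Set V)) :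
    (τ : ℝ) * cov2 a O ≤ (τ + 2) * cov2 a S := by
  set K := Finset.univ.biUnion B with hK
  set P := O.filter fun v => 0 < wdeg a v with hP
  -- Vertices of degree zero, to which `hspan` does not apply, contribute nothing.
  have hPO : cov2 a O ≤ cov2 a P := by
    have h := ha.cov2_union_le P (O.filter fun v => ¬ 0 < wdeg a v)
    rw [Finset.filter_union_filter_not_eq] at h
    rw [Finset.sum_eq_zero (s := O.filter fun v => ¬ 0 < wdeg a v)] at h
    · linarith
    · intro v hv
      exact le_antisymm (not_lt.1 (Finset.mem_filter.1 hv).2) (ha.wdeg_nonneg v)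
  have hPind : M.Indep (P : Set V) := hO.subset (Finset.coe_subset.2 (Finset.filter_subset _ _))
  set A := P ∩ K with hA
  set Q := P \ K with hQ
  have hPQ : P \ Q = A := by ext; simp [hQ, hA]
  have hrep (t : Fin τ) : ∃ X ⊆ B t, Disjoint A X ∧ M.Indep ((A ∪ X : Finset V) : Set V) ∧
      ∑ o ∈ Q, wdeg a o ≤ ∑ x ∈ X, wdeg a x := by
    rw [← hPQ]
    refine exists_replacement hE hPind Q Finset.sdiff_subset fun o ho => ?_
    obtain ⟨hoP, hoK⟩ := Finset.mem_sdiff.1 ho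
    refine hspan o (Finset.mem_filter.1 hoP).2 (fun t ht => hoK ?_) t
    exact Finset.mem_biUnion.2 ⟨t, Finset.mem_univ _, ht⟩
  choose X hXB hAX hXind hXsum using hrep
  have hAind : M.Indep (A : Set V) :=
    hPind.subset (Finset.coe_subset.2 Finset.inter_subset_left)
  -- Keeping A inside T protects the part of O that is already in the kernel: the exchanges below
  -- never remove an element of A.
  obtain ⟨T, hT, hTmax⟩ := Finset.exists_max_image
    (K.powerset.filter fun T => A ⊆ T ∧ M.Indep (T : Set V)) (cov2 a)
    ⟨A, Finset.mem_filter.2 ⟨Finset.mem_powerset.2 Finset.inter_subset_right, subset_rfl, hAind⟩⟩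
  rw [Finset.mem_filter, Finset.mem_powerset] at hT
  obtain ⟨hTK, hAT, hTind⟩ := hT
  have hXK (t : Fin τ) : A ∪ X t ⊆ K :=
    Finset.union_subset Finset.inter_subset_right
      ((hXB t).trans (Finset.subset_biUnion_of_mem B (Finset.mem_univ t)))
  have hex (t : Fin τ) : ∑ x ∈ X t, gain a T x ≤ ∑ x ∈ T \ A, gain a T x := by
    have h := sum_le_sum_of_forall_exchange hE hTind (hXind t) (c := gain a T)
      (fun x _ => ha.gain_nonneg T x)
      (fun y hy hyi => by
        obtain ⟨hyX, hyT⟩ := Finset.mem_sdiff.1 hy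
        have := hTmax (insert y T) (Finset.mem_filter.2 ⟨Finset.mem_powerset.2
          (Finset.insert_subset (hXK t hyX) hTK), hAT.trans (Finset.subset_insert _ _),
          by rwa [Finset.coe_insert]⟩)
        rw [ha.cov2_insert hyT] at this
        linarith)
      (fun y hy x hx hi => by
        obtain ⟨hyX, hyT⟩ := Finset.mem_sdiff.1 hy
        obtain ⟨hxT, hxX⟩ := Finset.mem_sdiff.1 hx
        have hxA : x ∉ A := fun h => hxX (Finset.mem_union_left _ h)
        have := hTmax (insert y (T.erase x)) (Finset.mem_filter.2 ⟨Finset.mem_powerset.2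
          (Finset.insert_subset (hXK t hyX) ((Finset.erase_subset _ _).trans hTK)),
          (Finset.subset_erase.2 ⟨hAT, hxA⟩).trans (Finset.subset_insert _ _), hi⟩)
        linarith [ha.cov2_exchange hxT hyT])
    rw [Finset.sum_union (hAX t)] at h
    linarith [Finset.sum_sdiff hAT (f := gain a T)]
  -- The sets X t are disjoint, so for each u in T its edges to all of them together weigh at most
  -- its degree. The total loss does not grow with τ.
  have hsumX : ∑ t, ∑ x ∈ X t, ∑ u ∈ T, a x u ≤ ∑ u ∈ T, wdeg a u := by
    rw [← Finset.sum_biUnion fun s _ t _ hst =>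
      (hB s t hst).mono (hXB s) (hXB t), Finset.sum_comm]
    refine Finset.sum_le_sum fun u _ => ?_
    rw [Finset.sum_congr rfl fun x _ => ha.symm x u]
    exact ha.sum_le_wdeg _ u
  have htot : (τ : ℝ) * ∑ o ∈ Q, wdeg a o - ∑ u ∈ T, wdeg a u ≤
      τ * ∑ x ∈ T \ A, gain a T x := by
    have h1 := Finset.sum_le_sum fun t (_ : t ∈ Finset.univ) => hex t
    have h2 := Finset.sum_le_sum fun t (_ : t ∈ Finset.univ) => hXsum t
    simp only [gain, Finset.sum_sub_distrib, Finset.sum_const, Finset.card_univ,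
      Fintype.card_fin, nsmul_eq_mul] at h1 h2 ⊢
    linarith
  have hgain := ha.sum_gain_le (A := A) (S := T) (R := T \ A)
    (by rw [Finset.union_sdiff_of_subset hAT]) Finset.disjoint_sdiff
  rw [Finset.union_sdiff_of_subset hAT] at hgain
  have hAQ := ha.cov2_union_le A Q
  rw [hA, hQ, Finset.inter_comm, Finset.union_comm, Finset.inter_comm,
    Finset.sdiff_union_inter] at hAQ
  have hTS := hS T hTK hTind
  have hTD := ha.sum_wdeg_le_cov2 T
  have hτ' : (0 : ℝ) < τ := by exact_mod_cast hτ
  have e1 : (τ : ℝ) * cov2 a O ≤ τ * (cov2 a A + 2 * ∑ o ∈ Q, wdeg a o) :=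
    mul_le_mul_of_nonneg_left (hPO.trans hAQ) hτ'.le
  have e2 := mul_le_mul_of_nonneg_left hgain hτ'.le
  -- The degree sum of T, at most `cov2 a T`, enters with the factor 2 of `hAQ`; hence τ + 2.
  have e3 : (τ : ℝ) * cov2 a O ≤ (τ + 2) * cov2 a T := by linarith
  exact e3.trans (mul_le_mul_of_nonneg_left hTS (by positivity))

end Exchange

/-! ### Covered weight in terms of the weighted adjacency matrix -/

section CoverWeight

variable {V : Type u}

open Classical in
/-- The weight of the edge between two vertices, and zero if they are not adjacent. -/
noncomputable def adjWeight (G : SimpleGraph V) (w : Sym2 V → ℝ) (u v : V) : ℝ :=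
  if G.Adj u v then w s(u, v) else 0

theorem isWeight_adjWeight {G : SimpleGraph V} {w : Sym2 V → ℝ}
    (hw : ∀ e ∈ G.edgeSet, 0 ≤ w e) : IsWeight (adjWeight G w) where
  symm u v := by rw [adjWeight, adjWeight, G.adj_comm u v, Sym2.eq_swap]
  nonneg u v := by
    unfold adjWeight
    split_ifs with h
    exacts [hw _ h, le_rfl]
  diag v := by simp [adjWeight]

-- Count ordered pairs (u, v) with u or v in S, in which each edge occurs twice, and apply
-- inclusion-exclusion to the two conditions.
open Classical in
theorem two_mul_coverWeight [Fintype V] [DecidableEq V] (G : SimpleGraph V) (w : Sym2 V → ℝ) (S : Finset V) :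
    2 * coverWeight G w (S : Set V) = cov2 (adjWeight G w) S := by
  have key : 2 * coverWeight G w (S : Set V) =
      ∑ u, ∑ v, if u ∈ S ∨ v ∈ S then adjWeight G w u v else 0 := by
    rw [← Finset.sum_product', Finset.univ_product_univ, coverWeight, Finset.mul_sum,
      ← Finset.sum_fiberwise Finset.univ (fun p : V × V => s(p.1, p.2))]
    refine Finset.sum_congr rfl fun e _ => ?_
    induction e with | _ x y
    by_cases hxy : G.Adj x y
    · have hne := hxy.ne
      have : (Finset.univ.filter fun p : V × V => s(p.1, p.2) = s(x, y)) = {(x, y), (y, x)} := by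
        ext ⟨u, v⟩
        simp
      rw [this, Finset.sum_pair (by simp [hne])]
      simp only [SimpleGraph.mem_edgeSet, hxy, true_and, Finset.mem_coe, Sym2.mem_iff, adjWeight,
        hxy.symm, if_true, Sym2.eq_swap (a := y)]
      have h1 : (∃ v ∈ S, v = x ∨ v = y) ↔ x ∈ S ∨ y ∈ S := by
        constructor
        · rintro ⟨v, hv, rfl | rfl⟩
          exacts [.inl hv, .inr hv]
        · rintro (h | h)
          exacts [⟨x, h, .inl rfl⟩, ⟨y, h, .inr rfl⟩]
      simp only [h1, or_comm (a := y ∈ S)]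
      ring
    · rw [if_neg (by simp [hxy]), mul_zero]
      refine (Finset.sum_eq_zero fun p hp => ?_).symm
      have hp' := (Finset.mem_filter.1 hp).2
      have : ¬ G.Adj p.1 p.2 := by
        rw [← SimpleGraph.mem_edgeSet, hp']
        exact hxy
      simp [adjWeight, this]
  have h1 : ∑ u, ∑ v, (if u ∈ S then adjWeight G w u v else 0) =
      ∑ u ∈ S, wdeg (adjWeight G w) u := by
    simp [wdeg]
  have h2 : ∑ u, ∑ v, (if v ∈ S then adjWeight G w u v else 0) =
      ∑ u ∈ S, wdeg (adjWeight G w) u := by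
    rw [Finset.sum_comm, ← h1]
    refine Finset.sum_congr rfl fun u _ => Finset.sum_congr rfl fun v _ => ?_
    rw [adjWeight, adjWeight, G.adj_comm u v, Sym2.eq_swap]
  have h3 : ∑ u, ∑ v, (if u ∈ S ∧ v ∈ S then adjWeight G w u v else 0) =
      ∑ u ∈ S, ∑ v ∈ S, adjWeight G w u v := by
    simp [ite_and]
  rw [key, cov2, ← h3, two_mul, ← h1]
  nth_rw 2 [h1]
  rw [← h2, ← Finset.sum_add_distrib, ← Finset.sum_sub_distrib]
  refine Finset.sum_congr rfl fun u _ => ?_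
  rw [← Finset.sum_add_distrib, ← Finset.sum_sub_distrib]
  refine Finset.sum_congr rfl fun v _ => ?_
  by_cases hu : u ∈ S <;> by_cases hv : v ∈ S <;> simp [hu, hv]

end CoverWeight

/-! ### The program -/

section Blocks

variable {V : Type u} {α β : Type} [DecidableEq α] [DecidableEq β] {M : Matroid V}

theorem Computes.congr {c : List (Cmd α β)} {f g : Mem V α β → Mem V α β}
    (h : Computes M c f) (hfg : ∀ m, f m = g m) : Computes M c g := by
  rwa [← funext hfg]

/-- Copy the registers `(x, σ i)` to the registers `(y, i)`, for all `i` in `R`. -/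
def copyVCode {n : ℕ} {J : Type} (y x : Fin n) (σ : J → J) (R : List J) :
    List (Cmd (Fin n × J) β) :=
  R.flatMap fun i => [.op (.copyV (y, i) (x, σ i))]

/-- Source and target blocks differ, so no copy overwrites a register that is still to be read. -/
theorem computes_copyV {n : ℕ} {J : Type} [DecidableEq J] {y x : Fin n} (hxy : x ≠ y) (σ : J → J)
    (R : List J) : Computes M (copyVCode (β := β) y x σ R) fun m =>
      { m with vtx := fun r => if r.1 = y ∧ r.2 ∈ R then m.vtx (x, σ r.2) else m.vtx r } := by
  refine (Computes.flatMap (fun i => Computes.op _) R).congr fun m => ?_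
  induction R generalizing m with
  | nil => simp
  | cons i R ih =>
    rw [List.foldl_cons, ih]
    simp only [Op.apply, Mem.mk.injEq, and_true]
    funext ⟨a, j⟩
    by_cases ha : a = y
    · by_cases hj : j = i
      · subst ha hj; simp [hxy]
      · simp [hxy, hj]
    · simp [ha]

/-- Copy the registers `(x, σ i)` to the registers `(y, i)`, for all `i` in `R`. -/
def copyWCode {n : ℕ} {J : Type} (y x : Fin n) (σ : J → J) (R : List J) :
    List (Cmd α (Fin n × J)) :=
  R.flatMap fun i => [.op (.copyW (y, i) (x, σ i))]

theorem computes_copyW {n : ℕ} {J : Type} [DecidableEq J] {y x : Fin n} (hxy : x ≠ y) (σ : J → J)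
    (R : List J) : Computes M (copyWCode (α := α) y x σ R) fun m =>
      { m with wt := fun r => if r.1 = y ∧ r.2 ∈ R then m.wt (x, σ r.2) else m.wt r } := by
  refine (Computes.flatMap (fun i => Computes.op _) R).congr fun m => ?_
  induction R generalizing m with
  | nil => simp
  | cons i R ih =>
    rw [List.foldl_cons, ih]
    simp only [Op.apply, Mem.mk.injEq, true_and]
    funext ⟨a, j⟩
    by_cases ha : a = y
    · by_cases hj : j = i
      · subst ha hj; simp [hxy]
      · simp [hxy, hj]
    · simp [ha]

/-- Empty the registers in `R`. -/
def clearVCode (R : List α) : List (Cmd α β) := R.flatMap fun r => [.op (.clearV r)]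

theorem computes_clearV (R : List α) : Computes M (clearVCode (β := β) R) fun m =>
    { m with vtx := fun r => if r ∈ R then none else m.vtx r } := by
  refine (Computes.flatMap (fun i => Computes.op _) R).congr fun m => ?_
  induction R generalizing m with
  | nil => simp
  | cons i R ih =>
    rw [List.foldl_cons, ih]
    simp only [Op.apply, Mem.mk.injEq, and_true]
    funext r
    by_cases hr : r = i <;> simp [hr]

/-- Set the registers in `R` to zero. -/
def zeroWCode (R : List β) : List (Cmd α β) := R.flatMap fun r => [.op (.zeroW r)]

theorem computes_zeroW (R : List β) : Computes M (zeroWCode (α := α) R) fun m =>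
    { m with wt := fun r => if r ∈ R then 0 else m.wt r } := by
  refine (Computes.flatMap (fun i => Computes.op _) R).congr fun m => ?_
  induction R generalizing m with
  | nil => simp
  | cons i R ih =>
    rw [List.foldl_cons, ih]
    simp only [Op.apply, Mem.mk.injEq, true_and]
    funext r
    by_cases hr : r = i <;> simp [hr]

/-- Add the weight variable `b` to those registers `r` in `R` for which the vertex variables `f r`
and `i` agree. -/
def addWhenCode (R : List β) (f : β → α) (i : α) (b : β) : List (Cmd α β) :=
  R.flatMap fun r => whenCode (.eqV (f r) i) true [.op (.addW r b)]

-- Without repetitions each register is increased at most once, and the summand `b` does not change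
-- because it is not in `R`.
open Classical in
theorem computes_addWhen {R : List β} (hR : R.Nodup) (f : β → α) (i : α) {b : β} (hb : b ∉ R) :
    Computes M (addWhenCode R f i b) fun m =>
      { m with wt := fun r => if r ∈ R ∧ m.vtx (f r) = m.vtx i then m.wt r + m.wt b
                else m.wt r } := by
  refine (Computes.flatMap (fun r => Computes.whenTrue _ (Computes.op _)) R).congr fun m => ?_
  induction R generalizing m with
  | nil => simp
  | cons r R ih =>
    rw [List.nodup_cons] at hR
    rw [List.mem_cons, not_or] at hb
    rw [List.foldl_cons, ih hR.2 hb.2]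
    simp only [Query.Holds]
    by_cases h : m.vtx (f r) = m.vtx i
    · simp only [h, if_true, Op.apply, Mem.mk.injEq, true_and]
      funext r'
      by_cases hr : r' = r
      · subst hr; simp [hR.1, h]
      · simp [hr, hb.1]
    · simp only [h, if_false, Mem.mk.injEq, true_and]
      funext r'
      by_cases hr : r' = r
      · subst hr; simp [hR.1, h]
      · simp [hr]

theorem computes_addW {ι : Type} (l : List ι) (g : ι → β) {b : β} (hb : ∀ i, g i ≠ b) :
    Computes M (α := α) (l.flatMap fun i => [.op (.addW b (g i))]) fun m =>
      { m with wt := Function.update m.wt b (m.wt b + (l.map fun i => m.wt (g i)).sum) } := by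
  refine (Computes.flatMap (fun i => Computes.op _) l).congr fun m => ?_
  induction l generalizing m with
  | nil => simp
  | cons i l ih =>
    rw [List.foldl_cons, ih]
    simp [Op.apply, Function.update_of_ne (hb _), add_assoc]

theorem computes_subW {ι : Type} (l : List ι) (g : ι → β) {b : β} (hb : ∀ i, g i ≠ b) :
    Computes M (α := α) (l.flatMap fun i => [.op (.subW b (g i))]) fun m =>
      { m with wt := Function.update m.wt b (m.wt b - (l.map fun i => m.wt (g i)).sum) } := by
  refine (Computes.flatMap (fun i => Computes.op _) l).congr fun m => ?_
  induction l generalizing m with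
  | nil => simp
  | cons i l ih =>
    rw [List.foldl_cons, ih]
    simp [Op.apply, Function.update_of_ne (hb _), sub_sub]

end Blocks

/-! ### Registers and code of the algorithm -/

variable {τ k : ℕ}

/-- The slots of the kernel: `k` slots for each of the `τ` levels. -/
abbrev Slot (τ k : ℕ) : Type := Fin τ × Fin k

/-- The vertex registers: `(0, some p)` is the slot `p` of the kernel, `(0, none)` is the vertex
that is being processed, `(1, _)` are temporary copies, `(2, some p)` are the slots of the
output, and `(3, none)` and `(4, none)` are for the items of the stream. -/
abbrev VReg (τ k : ℕ) : Type := Fin 5 × Option (Slot τ k)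

/-- The weight registers: `(0, p, q)` is the weight between the vertices in `p` and `q`, and
`(0, p, p)` the degree of the vertex in `p`; `(1, _)` are temporary copies; `(2, none, none)` is
for the items of the stream, `(3, none, none)` is the value of the set under consideration,
and `(4, none, none)` that of the best set. -/
abbrev WReg (τ k : ℕ) : Type := Fin 5 × Option (Slot τ k) × Option (Slot τ k)

/-- Memories of the program. -/
abbrev PMem (V : Type u) (τ k : ℕ) : Type u := Mem V (VReg τ k) (WReg τ k)

/-- Commands of the program. -/
abbrev PCmd (τ k : ℕ) : Type := Cmd (VReg τ k) (WReg τ k)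

/-- Rearrange the vertices and weights of the slots. -/
noncomputable def gatherCode (σ : Option (Slot τ k) → Option (Slot τ k)) : List (PCmd τ k) :=
  -- A permutation cannot be carried out in place by successive copies, hence the detour through
  -- block 1.
  (copyVCode 1 0 σ Finset.univ.toList ++ copyVCode 0 1 id Finset.univ.toList) ++
    (copyWCode 1 0 (Prod.map σ σ) Finset.univ.toList ++ copyWCode 0 1 id Finset.univ.toList)

/-- The registers with the data of the vertex that is being processed. -/
def carryRegs (τ k : ℕ) : Finset (WReg τ k) :=
  Finset.univ.filter fun r => r.1 = 0 ∧ (r.2.1 = none ∨ r.2.2 = none)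

/-- The vertex to which the weight in a register of `carryRegs` refers. -/
def carryVReg (r : WReg τ k) : VReg τ k :=
  -- For the degree register the far endpoint (4, none) is later compared with itself, so that every
  -- edge is added.
  if r.2 = (none, none) then (4, none) else (0, r.2.1.or r.2.2)

/-- The level of the slot `p`, with the slot replaced by the vertex that is being processed. -/
def swapRegs (p : Slot τ k) : Finset (VReg τ k) :=
  insert (0, none) ((Finset.univ.filter fun j => j ≠ p.2).image fun j => (0, some (p.1, j)))

/-- Exchange the slot `p` with the vertex that is being processed, if this is an improvement. -/
noncomputable def swapCode (p : Slot τ k) : List (PCmd τ k) :=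
  whenCode (.leW (0, none, none) (0, some p, some p)) false
    (whenCode (.indep (swapRegs p)) true (gatherCode (Equiv.swap none (some p))))

/-- Insert the vertex that is being processed into the kernel. -/
noncomputable def flushCode (τ k : ℕ) : List (PCmd τ k) :=
  (List.finRange τ).flatMap fun t => (List.finRange k).flatMap fun j => swapCode (t, j)

/-- Start with a new vertex. -/
noncomputable def resetCode (τ k : ℕ) : List (PCmd τ k) :=
  [.op (.copyV (0, none) (3, none))] ++ zeroWCode (carryRegs τ k).toList

/-- Compute the value of the set of the slots `A`. -/
noncomputable def valueCode (A : Finset (Slot τ k)) : List (PCmd τ k) :=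
  ([.op (.zeroW (3, none, none))] ++
    (A.toList.flatMap fun p => [.op (.addW (3, none, none) (0, some p, some p))])) ++
    ((A.toList.flatMap fun p => [.op (.addW (3, none, none) (0, some p, some p))]) ++
    (A.offDiag.toList.flatMap fun p => [.op (.subW (3, none, none) (0, some p.1, some p.2))]))

/-- Compare the set of the slots `A` with the best set. -/
noncomputable def tryCode (A : Finset (Slot τ k)) : List (PCmd τ k) :=
  valueCode A ++
    whenCode (.leW (3, none, none) (4, none, none)) false
      (whenCode (.indep (A.image fun p => (0, some p))) true
        ([.op (.copyW (4, none, none) (3, none, none))] ++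
          (clearVCode (Finset.univ.toList.map fun p => (2, p)) ++
            copyVCode 2 0 id (A.toList.map some))))

/-- The algorithm. -/
noncomputable def program (τ k : ℕ) : Program (VReg τ k) (WReg τ k) where
  -- A vertex is inserted only when the first edge of a different vertex shows that its own list is
  -- complete. The kernel is thus constant while a list is being read.
  body := whenCode (.eqV (0, none) (3, none)) false (flushCode τ k ++ resetCode τ k) ++
    addWhenCode (carryRegs τ k).toList carryVReg (4, none) (2, none, none)
  -- The last vertex is still to be inserted. The search has separate code for each set of slots, so
  -- enumerating them costs no variables beyond the program counter.
  final := flushCode τ k ++ (Finset.univ : Finset (Finset (Slot τ k))).toList.flatMap tryCode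
  inV := (3, none)
  inU := (4, none)
  inX := (2, none, none)
  out := Finset.univ.image fun p => (2, p)

/-! ### Effect of the code on the memory -/

section Functions

variable {V : Type u}

/-- The effect of `gatherCode σ`. -/
def gather (σ : Option (Slot τ k) → Option (Slot τ k)) (m : PMem V τ k) : PMem V τ k where
  vtx r := if r.1 = 0 ∨ r.1 = 1 then m.vtx (0, σ r.2) else m.vtx r
  wt r := if r.1 = 0 ∨ r.1 = 1 then m.wt (0, σ r.2.1, σ r.2.2) else m.wt r

theorem computes_gather (M : Matroid V) (σ : Option (Slot τ k) → Option (Slot τ k)) :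
    Computes M (gatherCode σ) (gather σ) := by
  refine (((computes_copyV (by decide) _ _).append (computes_copyV (by decide) _ _)).append
    ((computes_copyW (by decide) _ _).append (computes_copyW (by decide) _ _))).congr fun m => ?_
  simp only [gather, Mem.mk.injEq]
  constructor <;>
  · funext ⟨a, j⟩
    by_cases h0 : a = 0
    · simp [h0, Prod.map]
    · by_cases h1 : a = 1 <;> simp [h0, h1, Prod.map]

open Classical in
/-- The effect of `swapCode p`. -/
noncomputable def swapStep (M : Matroid V) (p : Slot τ k) (m : PMem V τ k) : PMem V τ k :=
  if ¬ m.wt (0, none, none) ≤ m.wt (0, some p, some p) ∧ M.Indep (m.stored (swapRegs p)) then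
    gather (Equiv.swap none (some p)) m
  else m

theorem computes_swap (M : Matroid V) (p : Slot τ k) :
    Computes M (swapCode p) (swapStep M p) := by
  refine (Computes.whenFalse _ (Computes.whenTrue _ (computes_gather M _))).congr fun m => ?_
  by_cases h1 : m.wt (0, none, none) ≤ m.wt (0, some p, some p) <;>
    by_cases h2 : M.Indep (m.stored (swapRegs p)) <;> simp [Query.Holds, swapStep, h1, h2]

/-- The effect of processing one level. -/
noncomputable def levelStep (M : Matroid V) (t : Fin τ) (m : PMem V τ k) : PMem V τ k :=
  (List.finRange k).foldl (fun m j => swapStep M (t, j) m) m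

/-- The effect of `flushCode`. -/
noncomputable def flush (M : Matroid V) (m : PMem V τ k) : PMem V τ k :=
  (List.finRange τ).foldl (fun m t => levelStep M t m) m

theorem computes_flush (M : Matroid V) : Computes M (flushCode τ k) (flush M) :=
  Computes.flatMap (fun _ => Computes.flatMap (fun _ => computes_swap M _) _) _

/-- The effect of `resetCode`. -/
def reset (m : PMem V τ k) : PMem V τ k where
  vtx := Function.update m.vtx (0, none) (m.vtx (3, none))
  wt r := if r ∈ carryRegs τ k then 0 else m.wt r

theorem computes_reset (M : Matroid V) : Computes M (resetCode τ k) reset :=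
  ((Computes.op _).append (computes_zeroW _)).congr fun m => by simp [Op.apply, reset]

open Classical in
/-- The effect of adding the weight of an item. -/
noncomputable def accumulate (m : PMem V τ k) : PMem V τ k where
  vtx := m.vtx
  wt r := if r ∈ carryRegs τ k ∧ m.vtx (carryVReg r) = m.vtx (4, none) then
    m.wt r + m.wt (2, none, none) else m.wt r

open Classical in
/-- The effect of the body of the loop. -/
noncomputable def bodyStep (M : Matroid V) (m : PMem V τ k) : PMem V τ k :=
  accumulate (if m.vtx (0, none) = m.vtx (3, none) then m else reset (flush M m))

theorem computes_accumulate (M : Matroid V) :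
    Computes M (addWhenCode (carryRegs τ k).toList carryVReg (4, none) (2, none, none))
      accumulate := by
  have h := computes_addWhen (M := M) (Finset.nodup_toList (carryRegs τ k)) carryVReg (4, none)
    (b := (2, none, none)) (by simp [carryRegs])
  refine h.congr fun m => ?_
  rw [accumulate, Mem.mk.injEq]
  refine ⟨rfl, funext fun r => ?_⟩
  split_ifs with h1 h2 h2
  · rfl
  · exact absurd ⟨Finset.mem_toList.1 h1.1, h1.2⟩ h2
  · exact absurd ⟨Finset.mem_toList.2 h2.1, h2.2⟩ h1
  · rfl

theorem computes_body (M : Matroid V) : Computes M (program τ k).body (bodyStep M) := by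
  refine ((Computes.whenFalse _ ((computes_flush M).append (computes_reset M))).append
    (computes_accumulate M)).congr fun m => ?_
  by_cases h : m.vtx (0, none) = m.vtx (3, none)
  · rw [bodyStep, if_pos h, if_neg (by simpa [Query.Holds] using h)]
  · rw [bodyStep, if_neg h, if_pos (by simpa [Query.Holds] using h)]

/-- The value computed for the set of the slots `A`. -/
def slotValue (m : PMem V τ k) (A : Finset (Slot τ k)) : ℝ :=
  2 * ∑ p ∈ A, m.wt (0, some p, some p) - ∑ p ∈ A.offDiag, m.wt (0, some p.1, some p.2)

/-- The effect of `valueCode A`. -/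
def valueStep (A : Finset (Slot τ k)) (m : PMem V τ k) : PMem V τ k :=
  { m with wt := Function.update m.wt (3, none, none) (slotValue m A) }

theorem computes_value (M : Matroid V) (A : Finset (Slot τ k)) :
    Computes M (valueCode A) (valueStep A) := by
  refine (((Computes.op _).append (computes_addW _ _ (by simp))).append
    ((computes_addW _ _ (by simp)).append (computes_subW _ _ (by simp)))).congr fun m => ?_
  have hv : slotValue m A = 0 + (A.toList.map fun p => m.wt (0, some p, some p)).sum +
      (A.toList.map fun p => m.wt (0, some p, some p)).sum -
      (A.offDiag.toList.map fun p => m.wt (0, some p.1, some p.2)).sum := by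
    rw [Finset.sum_map_toList, Finset.sum_map_toList, slotValue]
    ring
  simp only [valueStep, hv, Op.apply, Function.update_idem, Function.update_self, ne_eq,
    Prod.mk.injEq, not_false_eq_true, Function.update_of_ne, Fin.reduceEq, false_and]

open Classical in
/-- The effect of `tryCode A`, after the value has been computed. -/
noncomputable def storeStep (M : Matroid V) (A : Finset (Slot τ k)) (m : PMem V τ k) :
    PMem V τ k :=
  if ¬ m.wt (3, none, none) ≤ m.wt (4, none, none) ∧
      M.Indep (m.stored (A.image fun p => (0, some p))) then
    { vtx := fun r => if r.1 = 2 then if ∃ p ∈ A, r.2 = some p then m.vtx (0, r.2) else none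
        else m.vtx r
      wt := Function.update m.wt (4, none, none) (m.wt (3, none, none)) }
  else m

theorem computes_try (M : Matroid V) (A : Finset (Slot τ k)) :
    Computes M (tryCode A) (fun m => storeStep M A (valueStep A m)) := by
  refine (computes_value M A).append ((Computes.whenFalse _ (Computes.whenTrue _ ((Computes.op _).append
      ((computes_clearV _).append (computes_copyV (by decide) _ _))))).congr fun m => ?_)
  by_cases h1 : m.wt (3, none, none) ≤ m.wt (4, none, none)
  · simp [Query.Holds, storeStep, h1]
  by_cases h2 : M.Indep (m.stored (A.image fun p => (0, some p)))
  swap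
  · simp [Query.Holds, storeStep, h2]
  simp only [Query.Holds, storeStep, h1, h2, not_false_eq_true, and_self, if_true, Op.apply]
  simp only [Mem.mk.injEq, and_true]
  funext ⟨a, j⟩
  by_cases h : a = 2
  · simp [h, eq_comm]
  · simp [h, eq_comm]

/-- The effect of the last part of the program. -/
noncomputable def search (M : Matroid V) (m : PMem V τ k) : PMem V τ k :=
  (Finset.univ : Finset (Finset (Slot τ k))).toList.foldl (fun m A => storeStep M A (valueStep A m)) m

theorem computes_final (M : Matroid V) :
    Computes M (program τ k).final (fun m => search M (flush M m)) :=
  (computes_flush M).append (Computes.flatMap (fun A => computes_try M A) _)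

end Functions

/-! ### The invariants of the kernel -/

section Kernel

variable {V : Type u} {τ k : ℕ}

/-- The vertices in the slots of level `t`. -/
def level (v : Option (Slot τ k) → Option V) (t : Fin τ) : Set V :=
  {x | ∃ j, v (some (t, j)) = some x}

/-- The vertices in the slots of level `t`, and the vertex that is being processed. -/
def levelCarry (v : Option (Slot τ k) → Option V) (t : Fin τ) : Set V :=
  {x | v none = some x ∨ ∃ j, v (some (t, j)) = some x}

theorem level_congr {v v' : Option (Slot τ k) → Option V} {t : Fin τ}
    (h : ∀ j, v' (some (t, j)) = v (some (t, j))) : level v' t = level v t := by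
  simp only [level, h]

/-- The registers other than the slots and their temporary copies agree. -/
def SameRest (m m' : PMem V τ k) : Prop :=
  (∀ r, r.1 ≠ 0 → r.1 ≠ 1 → m'.vtx r = m.vtx r) ∧ ∀ r, r.1 ≠ 0 → r.1 ≠ 1 → m'.wt r = m.wt r

theorem SameRest.refl (m : PMem V τ k) : SameRest m m := ⟨fun _ _ _ => rfl, fun _ _ _ => rfl⟩

theorem SameRest.trans {m m' m'' : PMem V τ k} (h : SameRest m m') (h' : SameRest m' m'') :
    SameRest m m'' :=
  ⟨fun r h0 h1 => (h'.1 r h0 h1).trans (h.1 r h0 h1),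
    fun r h0 h1 => (h'.2 r h0 h1).trans (h.2 r h0 h1)⟩

theorem sameRest_swapStep {M : Matroid V} (p : Slot τ k) (m : PMem V τ k) : SameRest m (swapStep M p m) := by
  unfold swapStep
  split_ifs
  · exact ⟨fun r h0 h1 => by simp [gather, h0, h1], fun r h0 h1 => by simp [gather, h0, h1]⟩
  · exact SameRest.refl m

variable [Fintype V]

/-- The slots hold distinct vertices of positive degree, and each level is independent. -/
structure Valid (M : Matroid V) (a : V → V → ℝ) (seen : Set V)
    (v : Option (Slot τ k) → Option V) : Prop where
  inj : ∀ p q x, v p = some x → v q = some x → p = q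
  mem_seen : ∀ p x, v p = some x → x ∈ seen
  pos : ∀ (p : Slot τ k) (x : V), v (some p) = some x → 0 < wdeg a x
  indep : ∀ t, M.Indep (level v t)

/-- Each vertex is spanned by the vertices of larger degree in all levels before its own level;
for the vertex that is being processed, these are the first `L` levels. -/
def Spans (M : Matroid V) (a : V → V → ℝ) (seen : Set V) (L : ℕ)
    (v : Option (Slot τ k) → Option V) : Prop :=
  ∀ x ∈ seen, 0 < wdeg a x → ∀ t : Fin τ, (v none = some x → (t : ℕ) < L) →
    (∃ t' < t, x ∈ level v t') ∨ x ∈ M.closure {y | y ∈ level v t ∧ wdeg a x ≤ wdeg a y}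

/-- The weighted degree of the content of a variable. -/
def odeg (a : V → V → ℝ) (o : Option V) : ℝ := o.elim 0 (wdeg a)

/-- The state while level `t` is processed: the slots in `J` have been considered. -/
structure Pass (M : Matroid V) (a : V → V → ℝ) (seen : Set V) (v₀ : Option (Slot τ k) → Option V)
    (t : Fin τ) (J : Set (Fin k)) (v : Option (Slot τ k) → Option V) : Prop where
  valid : Valid M a seen v
  others : ∀ t' ≠ t, ∀ j, v (some (t', j)) = v₀ (some (t', j))
  all : levelCarry v t = levelCarry v₀ t
  considered : ∀ j ∈ J, ∀ z, v none = some z → 0 < wdeg a z →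
    M.Indep (levelCarry v₀ t \ {x | v (some (t, j)) = some x}) → wdeg a z ≤ odeg a (v (some (t, j)))

variable {M : Matroid V} {a : V → V → ℝ} {seen : Set V} {v₀ v : Option (Slot τ k) → Option V}
  {t : Fin τ} {J : Set (Fin k)}

theorem odeg_nonneg (ha : IsWeight a) (o : Option V) : 0 ≤ odeg a o := by
  cases o with
  | none => exact le_rfl
  | some x => exact ha.wdeg_nonneg x

theorem Pass.noSwap (h : Pass M a seen v₀ t J v) {j : Fin k}
    (hj : ¬ (odeg a (v (some (t, j))) < odeg a (v none) ∧
      M.Indep (levelCarry v t \ {x | v (some (t, j)) = some x}))) :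
    Pass M a seen v₀ t (insert j J) v := by
  refine ⟨h.valid, h.others, h.all, ?_⟩
  rintro j' (rfl | hj') z hz hpos hi
  · rw [h.all] at hj
    have : ¬ odeg a (v (some (t, j'))) < odeg a (v none) := fun h' => hj ⟨h', hi⟩
    rw [hz, not_lt] at this
    exact this
  · exact h.considered j' hj' z hz hpos hi

/-- The displaced vertex is lighter than the one replacing it, so a slot that resisted the old
carried vertex resists the new one too. An exchange does not change `levelCarry`, so the
independence condition for such a slot stays the same. Hence one sweep over the slots is enough. -/
theorem Pass.swap (ha : IsWeight a) (h : Pass M a seen v₀ t J v) {j : Fin k}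
    (hd : odeg a (v (some (t, j))) < odeg a (v none))
    (hi : M.Indep (levelCarry v t \ {x | v (some (t, j)) = some x})) :
    Pass M a seen v₀ t (insert j J) (fun p => v (Equiv.swap none (some (t, j)) p)) := by
  obtain ⟨⟨hinj, hseen, hpos, hind⟩, hoth, hall, hcon⟩ := h
  have hn : v (Equiv.swap none (some (t, j)) none) = v (some (t, j)) := by simp
  have hs : v (Equiv.swap none (some (t, j)) (some (t, j))) = v none := by simp
  have ho : ∀ p, p ≠ (t, j) → v (Equiv.swap none (some (t, j)) (some p)) = v (some p) := by
    intro p hp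
    rw [Equiv.swap_apply_of_ne_of_ne (by simp) (by simpa using hp)]
  have hot : ∀ t' ≠ t, ∀ j', v (Equiv.swap none (some (t, j)) (some (t', j'))) =
      v (some (t', j')) := fun t' ht' j' => ho _ (by simp [ht'])
  have hlevel : level (fun p => v (Equiv.swap none (some (t, j)) p)) t =
      levelCarry v t \ {x | v (some (t, j)) = some x} := by
    ext x
    constructor
    · rintro ⟨j', hj'⟩
      by_cases hjj : j' = j
      · subst hjj
        simp only [hs] at hj'
        exact ⟨.inl hj', fun h => by simpa using hinj _ _ _ hj' h⟩
      · simp only [ho (t, j') (by simpa using hjj)] at hj'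
        exact ⟨.inr ⟨j', hj'⟩, fun h => hjj (by simpa using hinj _ _ _ hj' h)⟩
    · rintro ⟨hx | ⟨j', hx⟩, hx'⟩
      · exact ⟨j, by simpa only [hs] using hx⟩
      · refine ⟨j', ?_⟩
        have hjj : j' ≠ j := by
          rintro rfl
          exact hx' hx
        simpa only [ho (t, j') (by simpa using hjj)] using hx
  refine ⟨⟨fun p q x hp hq => (Equiv.swap none (some (t, j))).injective (hinj _ _ x hp hq),
    fun p x hp => hseen _ x hp, fun p x hp => ?_, fun t' => ?_⟩, fun t' ht' j' => ?_, ?_, ?_⟩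
  · by_cases hpj : p = (t, j)
    · subst hpj
      rw [hs] at hp
      rw [hp] at hd
      exact (odeg_nonneg ha _).trans_lt hd
    · rw [ho p hpj] at hp
      exact hpos p x hp
  · by_cases ht' : t' = t
    · subst ht'
      rwa [hlevel]
    · rw [level_congr (hot t' ht')]
      exact hind t'
  · rw [hot t' ht', hoth t' ht']
  · rw [← hall]
    ext x
    constructor
    · rintro (hx | ⟨j', hx⟩)
      · exact .inr ⟨j, by simpa only [hn] using hx⟩
      · by_cases hjj : j' = j
        · subst hjj
          exact .inl (by simpa only [hs] using hx)
        · exact .inr ⟨j', by simpa only [ho (t, j') (by simpa using hjj)] using hx⟩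
    · rintro (hx | ⟨j', hx⟩)
      · exact .inr ⟨j, by simpa only [hs] using hx⟩
      · by_cases hjj : j' = j
        · subst hjj
          exact .inl (by simpa only [hn] using hx)
        · exact .inr ⟨j', by simpa only [ho (t, j') (by simpa using hjj)] using hx⟩
  · intro j' hj' z hz hzpos hi'
    simp only [hn] at hz
    rw [hz] at hd
    by_cases hjj : j' = j
    · subst hjj
      simp only [hs]
      exact hd.le
    · simp only [ho (t, j') (by simpa using hjj)] at hi' ⊢
      rcases hc : v none with - | c
      · rw [hc] at hd
        exact absurd hd (not_lt.2 hzpos.le)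
      · rw [hc] at hd
        exact hd.le.trans (hcon j' (hj'.resolve_left hjj) c hc (hzpos.trans hd) hi')

theorem Pass.mem_closure (hE : M.E = Set.univ) (hk : M.eRank = (k : ℕ∞))
    (h : Pass M a seen v₀ t Set.univ v) {z : V} (hz : v none = some z) (hpos : 0 < wdeg a z) :
    z ∈ M.closure {y | y ∈ level v t ∧ wdeg a z ≤ wdeg a y} := by
  obtain ⟨⟨hinj, hseen, hvpos, hind⟩, hoth, hall, hcon⟩ := h
  have hzl : z ∉ level v t := by
    rintro ⟨j, hj⟩
    simpa using hinj _ _ _ hz hj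
  have hlc : levelCarry v t = insert z (level v t) := by
    ext x
    simp only [levelCarry, hz, Option.some.injEq, level, Set.mem_ofPred_eq, Set.mem_insert_iff,
      eq_comm]
  -- If all k slots are full, one more element would exceed the rank. An empty slot would have taken
  -- z, since emptying it removes nothing.
  have hdep : ¬ M.Indep (insert z (level v t)) := by
    intro hi
    by_cases hfull : ∀ j, v (some (t, j)) ≠ none
    · have hcard : (level v t).encard = k := by
        choose f hf using fun j => Option.ne_none_iff_exists'.1 (hfull j)
        have hfi : Function.Injective f := by
          intro j j' hjj
          have := hinj _ _ _ (hf j) (hjj ▸ hf j')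
          simpa using this
        have : level v t = Set.range f := by
          ext x
          simp [level, hf]
        rw [this, ← Set.image_univ, hfi.encard_image, Set.encard_univ]
        simp
      have h1 := hi.encard_le_eRank
      rw [Set.encard_insert_of_notMem hzl, hcard, hk] at h1
      have : k + 1 ≤ k := by exact_mod_cast h1
      omega
    · push Not at hfull
      obtain ⟨j, hj⟩ := hfull
      have := hcon j trivial z hz hpos (by simpa [hj, ← hall, hlc] using hi)
      rw [hj] at this
      exact absurd hpos (not_lt.2 this)
  have hcl : z ∈ M.closure (level v t) := by
    rw [(hind t).mem_closure_iff_of_notMem hzl, Matroid.dep_iff]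
    exact ⟨hdep, by simp [hE]⟩
  -- Every other member of the fundamental circuit of z could have been exchanged for z, so its
  -- degree is at least that of z.
  have hC := (hind t).fundCircuit_isCircuit hcl hzl
  refine M.closure_subset_closure ?_
    (hC.mem_closure_sdiff_singleton_of_mem (M.mem_fundCircuit z _))
  intro y hy
  rw [M.fundCircuit_sdiff_eq_inter hzl] at hy
  have hyi := ((hind t).mem_fundCircuit_iff hcl hzl).1 hy.1
  obtain ⟨j, hj⟩ := hy.2
  refine ⟨hy.2, ?_⟩
  have := hcon j trivial z hz hpos (by
    rw [← hall, hlc]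
    convert hyi using 2
    ext x
    simp [hj, eq_comm])
  rwa [hj] at this

theorem Pass.spans (hE : M.E = Set.univ) (hk : M.eRank = (k : ℕ∞))
    (h : Pass M a seen v₀ t Set.univ v) (h₀ : Spans M a seen t v₀) :
    Spans M a seen (t + 1) v := by
  have hcl : ∀ z, v none = some z → 0 < wdeg a z →
      z ∈ M.closure {y | y ∈ level v t ∧ wdeg a z ≤ wdeg a y} :=
    fun z => h.mem_closure hE hk
  have hlev : ∀ t' ≠ t, level v t' = level v₀ t' := fun t' ht' => level_congr (h.others t' ht')
  have hmem : ∀ x ∈ levelCarry v₀ t, v none ≠ some x → x ∈ level v t := by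
    intro x hx hx'
    rw [← h.all] at hx
    exact hx.resolve_left hx'
  intro x hx hpos t' hc
  rcases lt_trichotomy t' t with htt | rfl | htt
  · rw [hlev t' htt.ne]
    rcases h₀ x hx hpos t' (fun _ => htt) with ⟨s, hs, hxs⟩ | h'
    · exact .inl ⟨s, hs, by rwa [hlev s (hs.trans htt).ne]⟩
    · exact .inr h'
  · by_cases hxc : v none = some x
    · exact .inr (hcl x hxc hpos)
    by_cases hx₀ : v₀ none = some x
    · exact .inr (M.mem_closure_of_mem ⟨hmem x (.inl hx₀) hxc, le_rfl⟩ (by simp [hE]))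
    rcases h₀ x hx hpos t' (fun h' => absurd h' hx₀) with ⟨s, hs, hxs⟩ | h'
    · exact .inl ⟨s, hs, by rwa [hlev s hs.ne]⟩
    · refine .inr (M.closure_subset_closure_of_subset_closure ?_ h')
      rintro y ⟨hy, hxy⟩
      by_cases hyc : v none = some y
      · refine M.closure_subset_closure ?_ (hcl y hyc (hpos.trans_le hxy))
        exact fun z hz => ⟨hz.1, hxy.trans hz.2⟩
      · exact M.mem_closure_of_mem ⟨hmem y (.inr hy) hyc, hxy⟩ (by simp [hE])
  -- Later levels are unchanged. If x was carried before and no longer is, it now sits in level t,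
  -- which precedes t'.
  · have hxc : v none ≠ some x := by
      intro h'
      have := hc h'
      have : (t : ℕ) < t' := htt
      omega
    by_cases hx₀ : v₀ none = some x
    · exact .inl ⟨t, htt, hmem x (.inl hx₀) hxc⟩
    rw [hlev t' htt.ne']
    rcases h₀ x hx hpos t' (fun h' => absurd h' hx₀) with ⟨s, hs, hxs⟩ | h'
    · by_cases hst : s = t
      · subst hst
        exact .inl ⟨s, hs, hmem x (.inr hxs) hxc⟩
      · exact .inl ⟨s, hs, by rwa [hlev s hst]⟩
    · exact .inr h'

/-- The vertices and weights of the slots agree with the edge weights `a`. -/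
structure Accurate (a : V → V → ℝ) (m : PMem V τ k) : Prop where
  deg : ∀ p, m.wt (0, p, p) = odeg a (m.vtx (0, p))
  weight : ∀ p q, p ≠ q →
    m.wt (0, p, q) = (m.vtx (0, p)).elim 0 fun x => (m.vtx (0, q)).elim 0 (a x)

theorem Accurate.gather {m : PMem V τ k} (h : Accurate a m)
    (σ : Equiv.Perm (Option (Slot τ k))) : Accurate a (gather σ m) where
  deg p := by simpa [MVC.gather] using h.deg (σ p)
  weight p q hpq := by simpa [MVC.gather] using h.weight (σ p) (σ q) (σ.injective.ne hpq)

/-- Since distinct slots hold distinct vertices, leaving out a register is the same as removing its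
vertex from the set. -/
theorem stored_swapRegs {m : PMem V τ k} (hv : Valid M a seen fun p => m.vtx (0, p)) (j : Fin k) :
    m.stored (swapRegs (t, j)) =
      levelCarry (fun p => m.vtx (0, p)) t \ {x | m.vtx (0, some (t, j)) = some x} := by
  ext x
  simp only [Mem.stored, swapRegs, Finset.mem_insert, Finset.mem_image, Finset.mem_filter,
    Finset.mem_univ, true_and, Set.mem_ofPred_eq, levelCarry, Set.mem_sdiff]
  constructor
  · rintro ⟨r, rfl | ⟨j', hj', rfl⟩, hr⟩
    · exact ⟨.inl hr, fun h => by simpa using hv.inj _ _ _ hr h⟩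
    · exact ⟨.inr ⟨j', hr⟩, fun h => hj' (by simpa using hv.inj _ _ _ hr h)⟩
  · rintro ⟨h | ⟨j', h⟩, h'⟩
    · exact ⟨_, .inl rfl, h⟩
    · refine ⟨_, .inr ⟨j', ?_, rfl⟩, h⟩
      rintro rfl
      exact h' h

theorem Accurate.swapStep {m : PMem V τ k} (h : Accurate a m) (p : Slot τ k) :
    Accurate a (swapStep M p m) := by
  unfold MVC.swapStep
  split_ifs
  exacts [h.gather _, h]

theorem Pass.swapStep (ha : IsWeight a) {m : PMem V τ k} (hm : Accurate a m)
    (h : Pass M a seen v₀ t J fun p => m.vtx (0, p)) (j : Fin k) :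
    Pass M a seen v₀ t (insert j J) fun p => (swapStep M (t, j) m).vtx (0, p) := by
  have hc := stored_swapRegs (t := t) h.valid j
  unfold MVC.swapStep
  split_ifs with hif <;> rw [hm.deg, hm.deg, hc, not_le] at hif
  · simpa [gather] using h.swap ha hif.1 hif.2
  · exact h.noSwap hif

theorem levelStep_spec (ha : IsWeight a) (hE : M.E = Set.univ) (hk : M.eRank = (k : ℕ∞))
    {m : PMem V τ k} (hm : Accurate a m) (hv : Valid M a seen fun p => m.vtx (0, p))
    (hs : Spans M a seen t fun p => m.vtx (0, p)) :
    Accurate a (levelStep M t m) ∧ (Valid M a seen fun p => (levelStep M t m).vtx (0, p)) ∧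
      (Spans M a seen (t + 1) fun p => (levelStep M t m).vtx (0, p)) ∧
      SameRest m (levelStep M t m) := by
  have key : ∀ (l : List (Fin k)) (J : Set (Fin k)) (m' : PMem V τ k), Accurate a m' →
      SameRest m m' → Pass M a seen (fun p => m.vtx (0, p)) t J (fun p => m'.vtx (0, p)) →
      Accurate a (l.foldl (fun m j => swapStep M (t, j) m) m') ∧
      SameRest m (l.foldl (fun m j => swapStep M (t, j) m) m') ∧
      Pass M a seen (fun p => m.vtx (0, p)) t (J ∪ {j | j ∈ l})
        (fun p => (l.foldl (fun m j => swapStep M (t, j) m) m').vtx (0, p)) := by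
    intro l
    induction l with
    | nil =>
      intro J m' h1 h2 h3
      exact ⟨h1, h2, by simpa using h3⟩
    | cons j l ih =>
      intro J m' h1 h2 h3
      have := ih (insert j J) (swapStep M (t, j) m') (h1.swapStep _)
        (h2.trans (sameRest_swapStep _ _)) (h3.swapStep ha h1 j)
      refine ⟨this.1, this.2.1, ?_⟩
      have hJ : J ∪ {i | i ∈ j :: l} = insert j J ∪ {i | i ∈ l} := by
        ext j'
        simp only [Set.mem_union, Set.mem_ofPred_eq, List.mem_cons, Set.mem_insert_iff]
        tauto
      rw [hJ]
      exact this.2.2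
  obtain ⟨h1, h2, h3⟩ := key (List.finRange k) ∅ m hm (SameRest.refl m)
    ⟨hv, fun _ _ _ => rfl, rfl, fun _ h => h.elim⟩
  have hu : (∅ ∪ {j | j ∈ List.finRange k} : Set (Fin k)) = Set.univ := by
    ext j
    simp
  rw [hu] at h3
  exact ⟨h1, h3.valid, h3.spans hE hk hs, h2⟩

theorem flush_spec (ha : IsWeight a) (hE : M.E = Set.univ) (hk : M.eRank = (k : ℕ∞))
    {m : PMem V τ k} (hm : Accurate a m) (hv : Valid M a seen fun p => m.vtx (0, p))
    (hs : Spans M a seen 0 fun p => m.vtx (0, p)) :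
    Accurate a (flush M m) ∧ (Valid M a seen fun p => (flush M m).vtx (0, p)) ∧
      (Spans M a seen τ fun p => (flush M m).vtx (0, p)) ∧ SameRest m (flush M m) := by
  -- The condition on l says that it lists consecutive levels from L on, so each level meets the
  -- bound that `levelStep_spec` requires.
  have key : ∀ (l : List (Fin τ)) (L : ℕ) (m' : PMem V τ k),
      l.map Fin.val = List.range' L l.length → Accurate a m' →
      (Valid M a seen fun p => m'.vtx (0, p)) → (Spans M a seen L fun p => m'.vtx (0, p)) →
      SameRest m m' →
      Accurate a (l.foldl (fun m t => levelStep M t m) m') ∧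
      (Valid M a seen fun p => (l.foldl (fun m t => levelStep M t m) m').vtx (0, p)) ∧
      (Spans M a seen (L + l.length)
        fun p => (l.foldl (fun m t => levelStep M t m) m').vtx (0, p)) ∧
      SameRest m (l.foldl (fun m t => levelStep M t m) m') := by
    intro l
    induction l with
    | nil => intro L m' _ h1 h2 h3 h4; exact ⟨h1, h2, h3, h4⟩
    | cons t l ih =>
      intro L m' hl h1 h2 h3 h4
      rw [List.map_cons, List.length_cons, List.range'_succ, List.cons.injEq] at hl
      obtain ⟨rfl, hl⟩ := hl
      obtain ⟨g1, g2, g3, g4⟩ := levelStep_spec ha hE hk h1 h2 h3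
      rw [List.length_cons, ← add_assoc, add_right_comm]
      exact ih _ _ hl g1 g2 g3 (h4.trans g4)
  have := key (List.finRange τ) 0 m (by simp [List.range_eq_range']) hm hv hs (SameRest.refl m)
  simpa [flush] using this

end Kernel

/-! ### The main loop -/

section Loop

variable {V : Type u} {τ k : ℕ}

/-- Nothing has been written to the output. -/
structure Fresh (m : PMem V τ k) : Prop where
  out : ∀ p, m.vtx (2, p) = none
  best : m.wt (4, none, none) = 0

/-- The memory after an item has been read. -/
noncomputable abbrev readMem (m : PMem V τ k) (e : V × V × ℝ) : PMem V τ k := (program τ k).readItem m e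

theorem readMem_vtx {m : PMem V τ k} {e : V × V × ℝ} {r : VReg τ k} (h3 : r.1 ≠ 3)
    (h4 : r.1 ≠ 4) : (readMem m e).vtx r = m.vtx r := by
  have e3 : r ≠ (3, none) := fun h => h3 (by rw [h])
  have e4 : r ≠ (4, none) := fun h => h4 (by rw [h])
  simp [Program.readItem, program, e3, e4]

theorem readMem_wt {m : PMem V τ k} {e : V × V × ℝ} {r : WReg τ k} (h2 : r.1 ≠ 2) :
    (readMem m e).wt r = m.wt r := by
  have e2 : r ≠ (2, none, none) := fun h => h2 (by rw [h])
  simp [Program.readItem, program, e2]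

theorem readMem_inV (m : PMem V τ k) (e : V × V × ℝ) :
    (readMem m e).vtx (3, none) = some e.1 := by
  simp [Program.readItem, program]

theorem readMem_inU (m : PMem V τ k) (e : V × V × ℝ) :
    (readMem m e).vtx (4, none) = some e.2.1 := by
  simp [Program.readItem, program]

theorem readMem_inX (m : PMem V τ k) (e : V × V × ℝ) :
    (readMem m e).wt (2, none, none) = e.2.2 := by
  simp [Program.readItem, program]

theorem Fresh.readMem {m : PMem V τ k} (h : Fresh m) (e : V × V × ℝ) : Fresh (readMem m e) where
  out p := by rw [readMem_vtx (by simp) (by simp), h.out]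
  best := by rw [readMem_wt (by simp), h.best]

variable [Fintype V] {M : Matroid V} {a : V → V → ℝ} {seen : Set V}

theorem Valid.newCarry {v v' : Option (Slot τ k) → Option V} {x : V} (h : Valid M a seen v)
    (hx : x ∉ seen) (hn : v' none = some x) (hv : ∀ p, v' (some p) = v (some p)) :
    Valid M a (insert x seen) v' where
  inj p q y hp hq := by
    rcases p with - | p <;> rcases q with - | q
    · rfl
    · rw [hn, Option.some.injEq] at hp
      subst hp
      exact absurd (h.mem_seen (some q) x (hv q ▸ hq)) hx
    · rw [hn, Option.some.injEq] at hq
      subst hq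
      exact absurd (h.mem_seen (some p) x (hv p ▸ hp)) hx
    · rw [hv] at hp hq
      exact h.inj _ _ _ hp hq
  mem_seen p y hp := by
    rcases p with - | p
    · rw [hn, Option.some.injEq] at hp
      exact .inl hp.symm
    · rw [hv] at hp
      exact .inr (h.mem_seen _ _ hp)
  pos p y hp := h.pos p y (hv p ▸ hp)
  indep t := by
    rw [level_congr fun j => hv (t, j)]
    exact h.indep t

/-- The vertex dropped after the last level is spanned in all τ levels, so it may be forgotten. The
new vertex has passed no level yet, so nothing is required of it. -/
theorem Spans.newCarry {v v' : Option (Slot τ k) → Option V} {x : V} (h : Spans M a seen τ v)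
    (hn : v' none = some x) (hv : ∀ p, v' (some p) = v (some p)) :
    Spans M a (insert x seen) 0 v' := by
  intro y hy hpos t hc
  have hl : ∀ t, level v' t = level v t := fun t => level_congr fun j => hv (t, j)
  simp only [hl]
  rcases hy with rfl | hy
  · exact absurd (hc hn) (Nat.not_lt_zero _)
  · exact h y hy hpos t fun _ => t.2

/-- All edges at the vertices in `seen` have been read. -/
structure Ready (M : Matroid V) (a : V → V → ℝ) (seen : Set V) (m : PMem V τ k) : Prop where
  accurate : Accurate a m
  valid : Valid M a seen fun p => m.vtx (0, p)
  spans : Spans M a seen 0 fun p => m.vtx (0, p)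
  fresh : Fresh m

open Classical in
/-- All edges at the vertices in `seen` have been read, and the edges from `x` to the vertices
in `done`. -/
structure Reading (M : Matroid V) (a : V → V → ℝ) (seen : Set V) (x : V) (done : List V)
    (m : PMem V τ k) : Prop where
  carry : m.vtx (0, none) = some x
  valid : Valid M a (insert x seen) fun p => m.vtx (0, p)
  spans : Spans M a (insert x seen) 0 fun p => m.vtx (0, p)
  deg : ∀ p : Slot τ k, m.wt (0, some p, some p) = odeg a (m.vtx (0, some p))
  weight : ∀ p q : Slot τ k, p ≠ q → m.wt (0, some p, some q) =
    (m.vtx (0, some p)).elim 0 fun x => (m.vtx (0, some q)).elim 0 (a x)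
  row : ∀ r ∈ carryRegs τ k, m.wt r = (done.map fun u =>
    if r.2 = (none, none) ∨ m.vtx (0, r.2.1.or r.2.2) = some u then a x u else 0).sum
  fresh : Fresh m

theorem Ready.readMem {m : PMem V τ k} (h : Ready M a seen m) (e : V × V × ℝ) :
    Ready M a seen (readMem m e) := by
  have hv : ∀ p, (MVC.readMem m e).vtx (0, p) = m.vtx (0, p) := fun p =>
    readMem_vtx (by simp) (by simp)
  have hw : ∀ p, (MVC.readMem m e).wt (0, p) = m.wt (0, p) := fun p => readMem_wt (by simp)
  refine ⟨⟨fun p => ?_, fun p q hpq => ?_⟩, ?_, ?_, h.fresh.readMem e⟩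
  · rw [hv, hw]; exact h.accurate.deg p
  · rw [hv, hv, hw]; exact h.accurate.weight p q hpq
  · simp only [hv]; exact h.valid
  · simp only [hv]; exact h.spans

theorem Reading.readMem {m : PMem V τ k} {x : V} {done : List V}
    (h : Reading M a seen x done m) (e : V × V × ℝ) :
    Reading M a seen x done (readMem m e) := by
  classical
  have hv : ∀ p, (MVC.readMem m e).vtx (0, p) = m.vtx (0, p) := fun p =>
    readMem_vtx (by simp) (by simp)
  have hw : ∀ p, (MVC.readMem m e).wt (0, p) = m.wt (0, p) := fun p => readMem_wt (by simp)
  refine ⟨by rw [hv]; exact h.carry, ?_, ?_, fun p => ?_, fun p q hpq => ?_, fun r hr => ?_,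
    h.fresh.readMem e⟩
  · simp only [hv]; exact h.valid
  · simp only [hv]; exact h.spans
  · rw [hv, hw]; exact h.deg p
  · rw [hv, hv, hw]; exact h.weight p q hpq
  · have h0 : r.1 = 0 := (Finset.mem_filter.1 hr).2.1
    rw [readMem_wt (by simp [h0]), h.row r hr]
    simp only [hv]

theorem Reading.accumulate {m : PMem V τ k} {x : V} {done : List V} {u : V}
    (h : Reading M a seen x done m) (hu : m.vtx (4, none) = some u)
    (hw : m.wt (2, none, none) = a x u) :
    Reading M a seen x (done ++ [u]) (MVC.accumulate m) := by
  classical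
  have hno : ∀ p q : Slot τ k, (MVC.accumulate m).wt (0, some p, some q) = m.wt (0, some p, some q) :=
    fun p q => by simp [MVC.accumulate, carryRegs]
  refine ⟨h.carry, h.valid, h.spans, fun p => ?_, fun p q hpq => ?_, fun r hr => ?_,
    ⟨h.fresh.out, ?_⟩⟩
  · rw [hno]; exact h.deg p
  · rw [hno]; exact h.weight p q hpq
  · have hcond : m.vtx (carryVReg r) = m.vtx (4, none) ↔
        (r.2 = (none, none) ∨ m.vtx (0, r.2.1.or r.2.2) = some u) := by
      unfold carryVReg
      by_cases h2 : r.2 = (none, none)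
      · simp [h2]
      · simp [h2, hu]
    simp only [MVC.accumulate, hr, true_and, hcond, h.row r hr, hw, List.map_append,
      List.map_cons, List.map_nil, List.sum_append, List.sum_singleton]
    split_ifs <;> simp
  · simpa [MVC.accumulate, carryRegs] using h.fresh.best

theorem Reading.bodyStep {m : PMem V τ k} {x : V} {done : List V}
    (h : Reading M a seen x done m) (u : V) :
    Reading M a seen x (done ++ [u]) (bodyStep M (MVC.readMem m (x, u, a x u))) := by
  have h' := h.readMem (x, u, a x u)
  unfold MVC.bodyStep
  rw [if_pos (by rw [h'.carry, readMem_inV])]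
  exact h'.accumulate (readMem_inU _ _) (readMem_inX _ _)

/-- The carried vertex, if any, has been seen before and so differs from x. Hence the kernel is
updated before the edge is recorded. -/
theorem Ready.bodyStep (ha : IsWeight a) (hE : M.E = Set.univ) (hk : M.eRank = (k : ℕ∞))
    {m : PMem V τ k} (h : Ready M a seen m) {x : V} (hx : x ∉ seen) (u : V) :
    Reading M a seen x [u] (bodyStep M (MVC.readMem m (x, u, a x u))) := by
  have h' := h.readMem (x, u, a x u)
  have hne : (MVC.readMem m (x, u, a x u)).vtx (0, none) ≠
      (MVC.readMem m (x, u, a x u)).vtx (3, none) := by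
    rw [readMem_inV]
    exact fun h₀ => hx (h'.valid.mem_seen none x h₀)
  unfold MVC.bodyStep
  rw [if_neg hne]
  have hU := readMem_inU m (x, u, a x u)
  have hV := readMem_inV m (x, u, a x u)
  have hX := readMem_inX m (x, u, a x u)
  generalize MVC.readMem m (x, u, a x u) = m₁ at *
  obtain ⟨hacc, hval, hsp, hv, hw⟩ := flush_spec ha hE hk h'.accurate h'.valid h'.spans
  generalize flush M m₁ = m₂ at *
  have hn : (reset m₂).vtx (0, none) = some x := by
    simp [reset, hv (3, none), hV]
  have hs : ∀ p, (reset m₂).vtx (0, some p) = m₂.vtx (0, some p) := fun p => by simp [reset]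
  have hwt : ∀ p q : Slot τ k, (reset m₂).wt (0, some p, some q) = m₂.wt (0, some p, some q) :=
    fun p q => by simp [reset, carryRegs]
  refine Reading.accumulate (done := []) ⟨hn, hval.newCarry hx hn hs, hsp.newCarry hn hs,
    fun p => ?_, fun p q hpq => ?_, fun r hr => by simp [reset, hr],
    ⟨fun p => ?_, ?_⟩⟩ ?_ ?_
  · rw [hs, hwt]; exact hacc.deg _
  · rw [hs, hs, hwt]; exact hacc.weight _ _ (by simpa using hpq)
  · simp [reset, hv (2, p), h'.fresh.out]
  · simp [reset, hw (4, none, none), h'.fresh.best, carryRegs]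
  · simp [reset, hv (4, none), hU]
  · simp [reset, hw (2, none, none), hX, carryRegs]

/-- Each neighbour was read once and other vertices have weight 0, so the sums over `done` are sums
over all vertices. Off the degree register only the term of the slot's own vertex survives. -/
theorem Reading.ready (ha : IsWeight a) {m : PMem V τ k} {x : V} {done : List V}
    (h : Reading M a seen x done m) (hd : done.Nodup) (hx : ∀ u, u ∉ done → a x u = 0) :
    Ready M a (insert x seen) m := by
  classical
  have hsum : ∀ g : V → ℝ, (∀ u, u ∉ done → g u = 0) → (done.map g).sum = ∑ u, g u := by
    intro g hg
    rw [← List.sum_toFinset g hd]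
    exact Finset.sum_subset (Finset.subset_univ _) fun u _ hu => hg u (by simpa using hu)
  have hrow : ∀ r ∈ carryRegs τ k, r.2 ≠ (none, none) → m.wt r =
      (m.vtx (0, r.2.1.or r.2.2)).elim 0 (a x) := by
    intro r hr hne
    rw [h.row r hr, hsum _ fun u hu => by simp [hx u hu]]
    rcases hv : m.vtx (0, r.2.1.or r.2.2) with - | y
    · simp [hne]
    · simp [hne]
  refine ⟨⟨fun p => ?_, fun p q hpq => ?_⟩, h.valid, h.spans, h.fresh⟩
  · rcases p with - | p
    · rw [h.carry, h.row _ (by simp [carryRegs]), hsum _ fun u hu => by simp [hx u hu]]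
      simp [odeg, wdeg]
    · exact h.deg p
  · rcases p with - | p <;> rcases q with - | q
    · exact absurd rfl hpq
    · rw [hrow _ (by simp [carryRegs]) (by simp), h.carry]
      rfl
    · rw [hrow _ (by simp [carryRegs]) (by simp), h.carry]
      change (m.vtx (0, some p)).elim 0 (a x) = _
      rcases m.vtx (0, some p) with - | y
      · rfl
      · exact ha.symm x y
    · exact h.weight p q (by simpa using hpq)

/-- This serves the isolated vertices, absent from the stream: their degree is 0, and `Spans` only
concerns positive degrees. -/
theorem Ready.insert {m : PMem V τ k} (h : Ready M a seen m) {x : V}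
    (hx : ∀ u, a x u = 0) : Ready M a (insert x seen) m := by
  refine ⟨h.accurate, ⟨h.valid.inj, fun p y hy => .inr (h.valid.mem_seen p y hy), h.valid.pos,
    h.valid.indep⟩, ?_, h.fresh⟩
  rintro y (rfl | hy) hpos
  · simp [wdeg, hx] at hpos
  · exact h.spans y hy hpos

/-- Executing the body of the loop for all items of a list. -/
noncomputable def runBody (M : Matroid V) (l : List (V × V × ℝ)) (m : PMem V τ k) : PMem V τ k :=
  l.foldl (fun m e => bodyStep M (readMem m e)) m

theorem Reading.runBody {x : V} (us : List V) {done : List V} {m : PMem V τ k}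
    (h : Reading M a seen x done m) :
    Reading M a seen x (done ++ us) (runBody M (us.map fun u => (x, u, a x u)) m) := by
  induction us generalizing done m with
  | nil => simpa [MVC.runBody] using h
  | cons u us ih => simpa [MVC.runBody] using ih (h.bodyStep u)

theorem Ready.runBody (ha : IsWeight a) (hE : M.E = Set.univ) (hk : M.eRank = (k : ℕ∞))
    {m : PMem V τ k} (h : Ready M a seen m) {x : V} (hx : x ∉ seen) {us : List V}
    (hd : us.Nodup) (hus : ∀ u, u ∉ us → a x u = 0) :
    Ready M a (Insert.insert x seen) (runBody M (us.map fun u => (x, u, a x u)) m) := by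
  rcases us with - | ⟨u, us⟩
  · exact h.insert fun u => hus u (by simp)
  · exact ((h.bodyStep ha hE hk hx u).runBody us).ready ha hd hus

theorem Ready.stream (ha : IsWeight a) (hE : M.E = Set.univ) (hk : M.eRank = (k : ℕ∞))
    {nbrs : V → List V} (hd : ∀ x, (nbrs x).Nodup) (hn : ∀ x u, u ∉ nbrs x → a x u = 0)
    (order : List V) (ho : order.Nodup) {m : PMem V τ k} (h : Ready M a seen m)
    (hs : ∀ x ∈ order, x ∉ seen) :
    Ready M a (seen ∪ {x | x ∈ order})
      (MVC.runBody M (order.flatMap fun x => (nbrs x).map fun u => (x, u, a x u)) m) := by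
  induction order generalizing seen m with
  | nil => simpa [MVC.runBody] using h
  | cons x order ih =>
    rw [List.nodup_cons] at ho
    have h1 := h.runBody ha hE hk (hs x (by simp)) (hd x) (hn x)
    have h2 := ih ho.2 h1 fun y hy => by
      rintro (rfl | hys)
      exacts [ho.1 hy, hs y (List.mem_cons_of_mem _ hy) hys]
    have hset : seen ∪ {y | y ∈ x :: order} = Insert.insert x seen ∪ {y | y ∈ order} := by
      ext y
      simp only [Set.mem_union, Set.mem_ofPred_eq, List.mem_cons, Set.mem_insert_iff]
      tauto
    rw [hset]
    simpa [MVC.runBody, List.foldl_append] using h2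

theorem ready_init : Ready M a (∅ : Set V) (⟨fun _ => none, fun _ => 0⟩ : PMem V τ k) := by
  refine ⟨⟨fun p => rfl, fun p q _ => rfl⟩, ⟨?_, ?_, ?_, fun t => ?_⟩, ?_, ⟨fun _ => rfl, rfl⟩⟩
  · intro p q x hp; simp at hp
  · intro p x hp; simp at hp
  · intro p x hp; simp at hp
  · convert M.empty_indep
    ext x
    simp [level]
  · intro x hx
    exact hx.elim

end Loop

/-! ### The exhaustive search -/

section Search

variable {V : Type u} {τ k : ℕ} [DecidableEq V]

/-- The vertices in the slots `A`. -/
def content (v : Option (Slot τ k) → Option V) (A : Finset (Slot τ k)) : Finset V :=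
  A.biUnion fun p => (v (some p)).toFinset

theorem mem_content {v : Option (Slot τ k) → Option V} {A : Finset (Slot τ k)} {x : V} :
    x ∈ content v A ↔ ∃ p ∈ A, v (some p) = some x := by
  simp [content, Option.mem_toFinset]

variable [Fintype V] {M : Matroid V} {a : V → V → ℝ} {seen : Set V}

theorem Valid.sum_content {v : Option (Slot τ k) → Option V} (h : Valid M a seen v)
    (A : Finset (Slot τ k)) (g : V → ℝ) :
    ∑ x ∈ content v A, g x = ∑ p ∈ A, (v (some p)).elim 0 g := by
  rw [content, Finset.sum_biUnion]
  · refine Finset.sum_congr rfl fun p _ => ?_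
    cases v (some p) <;> simp
  · intro p _ q _ hpq
    rw [Function.onFun, Finset.disjoint_left]
    intro x hp hq
    rw [Option.mem_toFinset] at hp hq
    exact hpq (by simpa using h.inj _ _ x hp hq)

/-- The diagonal registers hold degrees and not the weights a v v = 0, so the double sum runs over
off-diagonal pairs. Empty slots contribute 0. -/
theorem slotValue_eq (ha : IsWeight a) {m : PMem V τ k} (hacc : Accurate a m)
    (h : Valid M a seen fun p => m.vtx (0, p)) (A : Finset (Slot τ k)) :
    slotValue m A = cov2 a (content (fun p => m.vtx (0, p)) A) := by
  rw [slotValue, cov2, h.sum_content]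
  congr 1
  · exact congrArg _ (Finset.sum_congr rfl fun p _ => hacc.deg _)
  · have h1 : ∀ x, ∑ u ∈ content (fun p => m.vtx (0, p)) A, a x u =
        ∑ q ∈ A, (m.vtx (0, some q)).elim 0 (a x) := fun x => h.sum_content A _
    simp only [h1]
    rw [h.sum_content A fun x => ∑ q ∈ A, (m.vtx (0, some q)).elim 0 (a x)]
    have h2 : ∀ p ∈ A, ((m.vtx (0, some p)).elim 0 fun x =>
        ∑ q ∈ A, (m.vtx (0, some q)).elim 0 (a x)) =
        ∑ q ∈ A, if p ≠ q then m.wt (0, some p, some q) else 0 := by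
      intro p _
      rcases hp : m.vtx (0, some p) with - | x
      · refine (Finset.sum_eq_zero fun q _ => ?_).symm
        split_ifs with hpq
        · rw [hacc.weight _ _ (by simpa using hpq), hp]
          rfl
        · rfl
      · refine Finset.sum_congr rfl fun q _ => ?_
        split_ifs with hpq
        · rw [hacc.weight _ _ (by simpa using hpq), hp]
          rfl
        · rw [not_not] at hpq
          simp [← hpq, hp, ha.diag]
    rw [Finset.sum_congr rfl h2, ← Finset.sum_product', ← Finset.sum_filter]
    exact Finset.sum_congr (by ext; simp [and_assoc]) fun _ _ => rfl

open Classical in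
/-- The state of the search after the sets in `done` have been considered. -/
structure Best (M : Matroid V) (a : V → V → ℝ) (m₀ : PMem V τ k)
    (done : Set (Finset (Slot τ k))) (m : PMem V τ k) : Prop where
  vtx : ∀ p, m.vtx (0, p) = m₀.vtx (0, p)
  wt : ∀ p q, m.wt (0, p, q) = m₀.wt (0, p, q)
  out_none : m.vtx (2, none) = none
  exists_best : ∃ A, (∀ p, m.vtx (2, some p) = if p ∈ A then m₀.vtx (0, some p) else none) ∧
    M.Indep (content (fun p => m₀.vtx (0, p)) A : Set V) ∧
    m.wt (4, none, none) = cov2 a (content (fun p => m₀.vtx (0, p)) A)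
  le_best : ∀ A ∈ done, M.Indep (content (fun p => m₀.vtx (0, p)) A : Set V) →
    cov2 a (content (fun p => m₀.vtx (0, p)) A) ≤ m.wt (4, none, none)

theorem Best.step (ha : IsWeight a) {m₀ m : PMem V τ k} (hacc : Accurate a m₀)
    (hv : Valid M a seen fun p => m₀.vtx (0, p)) {done : Set (Finset (Slot τ k))}
    (h : Best M a m₀ done m) (A : Finset (Slot τ k)) :
    Best M a m₀ (insert A done) (storeStep M A (valueStep A m)) := by
  obtain ⟨hvtx, hwt, hnone, ⟨A₀, hA₀, hi₀, hb₀⟩, hle⟩ := h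
  have hval : slotValue m A = cov2 a (content (fun p => m₀.vtx (0, p)) A) := by
    rw [← slotValue_eq ha hacc hv A]
    simp only [slotValue, hwt]
  have hst : (valueStep A m).stored (A.image fun p => (0, some p)) =
      (content (fun p => m₀.vtx (0, p)) A : Set V) := by
    ext x
    simp only [Mem.stored, Finset.mem_image, Set.mem_ofPred_eq, Finset.mem_coe, mem_content,
      valueStep]
    constructor
    · rintro ⟨_, ⟨p, hp, rfl⟩, hx⟩
      exact ⟨p, hp, by rw [← hvtx]; exact hx⟩
    · rintro ⟨p, hp, hx⟩
      exact ⟨_, ⟨p, hp, rfl⟩, by rw [hvtx]; exact hx⟩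
  have h3 : (valueStep A m).wt (3, none, none) =
      cov2 a (content (fun p => m₀.vtx (0, p)) A) := by
    simp [valueStep, hval]
  have h4 : (valueStep A m).wt (4, none, none) = m.wt (4, none, none) := by
    simp [valueStep]
  have h0 : ∀ p q, (valueStep A m).wt (0, p, q) = m₀.wt (0, p, q) := by
    simp [valueStep, hwt]
  have hv' : (valueStep A m).vtx = m.vtx := rfl
  unfold storeStep
  split_ifs with hif <;> rw [hst, h3, h4, not_le] at hif
  · refine ⟨fun p => by simp [hv', hvtx], fun p q => by simp [h0], by simp,
      ⟨A, fun p => ?_, hif.2, by simp [h3]⟩, ?_⟩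
    · simp [hv', hvtx]
    · rintro A' (rfl | hA') hi
      · simp [h3]
      · simpa [h3] using (hle A' hA' hi).trans hif.1.le
  · refine ⟨fun p => by rw [hv', hvtx], h0, by rw [hv', hnone], ⟨A₀, fun p => ?_, hi₀, ?_⟩, ?_⟩
    · rw [hv', hA₀]
    · rw [h4, hb₀]
    · rintro A' (rfl | hA') hi
      · rw [h4]
        exact not_lt.1 fun hlt => hif ⟨hlt, hi⟩
      · rw [h4]
        exact hle A' hA' hi

/-- The search finds an independent set of the largest value. -/
theorem search_spec (ha : IsWeight a) {m : PMem V τ k} (hacc : Accurate a m)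
    (hv : Valid M a seen fun p => m.vtx (0, p)) (hf : Fresh m) :
    ∃ S : Finset V, (search M m).stored (program τ k).out = S ∧ M.Indep (S : Set V) ∧
      ∀ T : Finset V, (∀ x ∈ T, ∃ p, m.vtx (0, some p) = some x) → M.Indep (T : Set V) →
        cov2 a T ≤ cov2 a S := by
  classical
  have key : ∀ (l : List (Finset (Slot τ k))) (done : Set (Finset (Slot τ k))) (m' : PMem V τ k),
      Best M a m done m' →
      Best M a m (done ∪ {A | A ∈ l}) (l.foldl (fun m A => storeStep M A (valueStep A m)) m') := by
    intro l
    induction l with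
    | nil => intro done m' h; simpa using h
    | cons A l ih =>
      intro done m' h
      have hset : done ∪ {B | B ∈ A :: l} = insert A done ∪ {B | B ∈ l} := by
        ext B
        simp only [Set.mem_union, Set.mem_ofPred_eq, List.mem_cons, Set.mem_insert_iff]
        tauto
      rw [hset]
      exact ih _ _ (h.step ha hacc hv A)
  -- Fresh output registers represent the empty set, of value 0, from which the search starts.
  obtain ⟨h1, h2, h3, ⟨A, hA, hi, hb⟩, hle⟩ := key Finset.univ.toList ∅ m
    ⟨fun _ => rfl, fun _ _ => rfl, hf.out _, ⟨∅, fun p => by simp [hf.out], by simp [content],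
      by simp [content, cov2, hf.best]⟩, fun _ h => h.elim⟩
  refine ⟨content (fun p => m.vtx (0, p)) A, ?_, hi, fun T hT hTi => ?_⟩
  · ext x
    simp only [Mem.stored, program, Finset.mem_image, Finset.mem_univ, true_and,
      Set.mem_ofPred_eq, Finset.mem_coe, mem_content]
    constructor
    · rintro ⟨_, ⟨p, rfl⟩, hx⟩
      rcases p with - | p
      · rw [search, h3] at hx
        cases hx
      · rw [search, hA] at hx
        split_ifs at hx with hp
        exact ⟨p, hp, hx⟩
    · rintro ⟨p, hp, hx⟩
      refine ⟨_, ⟨some p, rfl⟩, ?_⟩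
      rw [search, hA, if_pos hp]
      exact hx
  · have hTA : T = content (fun p => m.vtx (0, p))
        (Finset.univ.filter fun p => ∃ x ∈ T, m.vtx (0, some p) = some x) := by
      ext x
      simp only [mem_content, Finset.mem_filter, Finset.mem_univ, true_and]
      constructor
      · intro hx
        obtain ⟨p, hp⟩ := hT x hx
        exact ⟨p, ⟨x, hx, hp⟩, hp⟩
      · rintro ⟨p, ⟨y, hy, hpy⟩, hpx⟩
        rw [hpy, Option.some.injEq] at hpx
        exact hpx ▸ hy
    rw [hTA] at hTi ⊢
    rw [← hb]
    exact hle _ (by simp) hTi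

end Search

/-! ### The number of variables -/

section Size

variable {τ k : ℕ}

theorem card_slots : Fintype.card (Option (Slot τ k)) = τ * k + 1 := by simp

theorem length_copyVCode {β : Type} {n : ℕ} {J : Type} (y x : Fin n) (σ : J → J) (R : List J) :
    (copyVCode (β := β) y x σ R).length = R.length := by
  simp [copyVCode, List.length_flatMap]

theorem length_copyWCode {α : Type} {n : ℕ} {J : Type} (y x : Fin n) (σ : J → J) (R : List J) :
    (copyWCode (α := α) y x σ R).length = R.length := by
  simp [copyWCode, List.length_flatMap]

theorem length_gatherCode (σ : Option (Slot τ k) → Option (Slot τ k)) :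
    (gatherCode σ).length = 2 * (τ * k + 1) + 2 * (τ * k + 1) ^ 2 := by
  simp only [gatherCode, List.length_append, length_copyVCode, length_copyWCode,
    Finset.length_toList, Finset.card_univ, Fintype.card_prod, card_slots]
  ring

theorem length_flushCode : (flushCode τ k).length =
    τ * (k * (2 * (τ * k + 1) + 2 * (τ * k + 1) ^ 2 + 2)) := by
  simp [flushCode, swapCode, whenCode, List.length_flatMap, length_gatherCode]

theorem card_carryRegs_le : (carryRegs τ k).card ≤ 5 * (τ * k + 1) ^ 2 := by
  refine (Finset.card_le_univ _).trans (le_of_eq ?_)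
  rw [Fintype.card_prod, Fintype.card_prod, card_slots, Fintype.card_fin, sq]

theorem length_tryCode_le (A : Finset (Slot τ k)) :
    (tryCode A).length ≤ 9 * (τ * k + 1) ^ 2 := by
  have hA : A.card ≤ τ * k := by simpa using Finset.card_le_univ A
  have hA' : A.offDiag.card ≤ (τ * k) * (τ * k) :=
    A.offDiag_card.trans_le ((Nat.sub_le _ _).trans (Nat.mul_le_mul hA hA))
  have hlen : (tryCode A).length = 1 + A.card + (A.card + A.offDiag.card) +
      (1 + (τ * k + 1 + A.card) + 1 + 1) := by
    simp only [tryCode, valueCode, whenCode, clearVCode, List.length_append, List.length_cons,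
      List.length_nil, List.length_flatMap, length_copyVCode, List.length_map,
      Finset.length_toList, List.map_const', List.sum_replicate, Finset.card_univ, card_slots,
      smul_eq_mul, mul_one, zero_add]
  rw [hlen]
  nlinarith

/-- The exponential factor serves only to give both phases the same bound, since they share one L.
-/
theorem length_body_le : (program τ k).body.length ≤ 2 ^ (τ * k) * (24 * (τ * k + 1) ^ 3) := by
  have h1 : 1 ≤ 2 ^ (τ * k) := Nat.one_le_two_pow
  have h2 := card_carryRegs_le (τ := τ) (k := k)
  have h3 : (program τ k).body.length ≤ 24 * (τ * k + 1) ^ 3 := by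
    simp only [program, whenCode, resetCode, zeroWCode, addWhenCode, List.length_append,
      List.length_cons, List.length_nil, List.length_flatMap, length_flushCode,
      Finset.length_toList, List.map_const', List.sum_replicate, smul_eq_mul, mul_one, zero_add]
    generalize (carryRegs τ k).card = c at *
    rw [← mul_assoc]
    generalize τ * k = N at *
    nlinarith
  nlinarith

theorem length_final_le : (program τ k).final.length ≤ 2 ^ (τ * k) * (24 * (τ * k + 1) ^ 3) := by
  have h1 : 1 ≤ 2 ^ (τ * k) := Nat.one_le_two_pow
  have h2 : ((Finset.univ : Finset (Finset (Slot τ k))).toList.flatMap tryCode).length ≤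
      2 ^ (τ * k) * (9 * (τ * k + 1) ^ 2) := by
    rw [List.length_flatMap]
    refine (List.sum_le_card_nsmul _ (9 * (τ * k + 1) ^ 2) fun n hn => ?_).trans (le_of_eq ?_)
    · obtain ⟨A, -, rfl⟩ := List.mem_map.1 hn
      exact length_tryCode_le A
    · simp
  have h3 : (flushCode τ k).length ≤ 6 * (τ * k + 1) ^ 3 := by
    rw [length_flushCode, ← mul_assoc]
    generalize τ * k = N
    nlinarith
  have h4 : (program τ k).final.length = (flushCode τ k).length +
      ((Finset.univ : Finset (Finset (Slot τ k))).toList.flatMap tryCode).length :=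
    List.length_append
  rw [h4]
  generalize 2 ^ (τ * k) = K at *
  generalize τ * k = N at *
  have h5 : 9 * (N + 1) ^ 2 ≤ 18 * (N + 1) ^ 3 := by nlinarith [Nat.zero_le N]
  have h6 := Nat.mul_le_mul_left K h5
  nlinarith

theorem exists_program_layout (hτ : 0 < τ) (hk : 0 < k) :
    Nonempty (Layout (VReg τ k) (WReg τ k) (20 * (τ * k) ^ 2)
      (2 ^ (τ * k) * (24 * (τ * k + 1) ^ 3))) := by
  have hN : 1 ≤ τ * k := Nat.mul_pos hτ hk
  apply exists_layout
  · rw [Fintype.card_prod, card_slots, Fintype.card_fin]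
    nlinarith
  · rw [Fintype.card_prod, Fintype.card_prod, card_slots, Fintype.card_fin]
    nlinarith
  · generalize τ * k = N at *
    -- Of the N + 4 factors, N absorb 2^N and the other four absorb the cubic polynomial. The
    -- constant 20 is 5·4: there are five blocks of (N + 1)² weight registers, and N + 1 ≤ 2N.
    have h1 : (20 * N ^ 2 + 1) ^ (N + 4) ≤ (20 * N ^ 2 + 1) ^ (20 * N ^ 2) :=
      Nat.pow_le_pow_right (by omega) (by nlinarith)
    refine le_trans ?_ h1
    rw [pow_add]
    have h2 : 2 ^ N ≤ (20 * N ^ 2 + 1) ^ N := Nat.pow_le_pow_left (by nlinarith) N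
    have h3 : 100 * (N + 1) ^ 3 ≤ (20 * N ^ 2 + 1) ^ 4 := by
      have h4 : (N + 1) ^ 3 ≤ (2 * N) ^ 3 := Nat.pow_le_pow_left (by omega) 3
      have h5 : (20 * N) ^ 4 ≤ (20 * N ^ 2 + 1) ^ 4 := Nat.pow_le_pow_left (by nlinarith) 4
      have h6 : N ^ 3 ≤ N ^ 4 := Nat.pow_le_pow_right hN (by norm_num)
      calc 100 * (N + 1) ^ 3 ≤ 800 * N ^ 3 := by linarith [mul_pow 2 N 3]
        _ ≤ (20 * N) ^ 4 := by rw [mul_pow]; linarith [Nat.zero_le (N ^ 4)]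
        _ ≤ _ := h5
    have h7 : 1 ≤ 2 ^ N := Nat.one_le_two_pow
    have h8 : 1 ≤ (N + 1) ^ 3 := Nat.one_le_pow _ _ (by omega)
    have h9 : 1 ≤ 2 ^ N * (N + 1) ^ 3 := Nat.mul_le_mul h7 h8
    calc 2 * (2 ^ N * (24 * (N + 1) ^ 3) + 1) ≤ 2 ^ N * (100 * (N + 1) ^ 3) := by linarith
      _ ≤ _ := Nat.mul_le_mul h2 h3

end Size

/-! ### The main theorem -/

section Main

variable {V : Type u} [Fintype V] [DecidableEq V] {G : SimpleGraph V} {w : Sym2 V → ℝ}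
  {M : Matroid V} {l : List (V × V × ℝ)} {τ k : ℕ}

theorem coverWeight_nonneg (hw : ∀ e ∈ G.edgeSet, 0 ≤ w e) (S : Set V) :
    0 ≤ coverWeight G w S := by
  refine Finset.sum_nonneg fun e _ => ?_
  split_ifs with h
  exacts [hw e h.1, le_rfl]

/-- The independent set that the program outputs. -/
theorem exists_output (hτ : 0 < τ) (hw : ∀ e ∈ G.edgeSet, 0 ≤ w e) (hE : M.E = Set.univ)
    (hk : M.eRank = (k : ℕ∞)) (hl : IsIncidenceStream G w l) :
    ∃ S : Finset V,
      (search M (flush M (runBody M l ⟨fun _ => none, fun _ => 0⟩))).stored (program τ k).out = S ∧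
      M.Indep (S : Set V) ∧ ∀ O : Finset V, M.Indep (O : Set V) →
        (τ : ℝ) * cov2 (adjWeight G w) O ≤ (τ + 2) * cov2 (adjWeight G w) S := by
  classical
  obtain ⟨order, nbrs, ⟨ho, hall⟩, hn, rfl⟩ := hl
  have ha := isWeight_adjWeight hw
  have hstream : (order.flatMap fun v => (nbrs v).map fun u => (v, u, w s(v, u))) =
      order.flatMap fun v => (nbrs v).map fun u => (v, u, adjWeight G w v u) := by
    refine List.flatMap_congr fun v _ => List.map_congr_left fun u hu => ?_
    rw [adjWeight, if_pos (((hn v).2 u).1 hu)]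
  have hready := (ready_init (M := M) (a := adjWeight G w) (τ := τ) (k := k)).stream ha hE hk
    (fun v => (hn v).1)
    (fun v u hu => by rw [adjWeight, if_neg fun h => hu (((hn v).2 u).2 h)]) order ho
    (fun _ _ h => h)
  rw [← hstream] at hready
  obtain ⟨hacc, hval, hsp, hsame⟩ := flush_spec ha hE hk hready.accurate hready.valid hready.spans
  have hfresh : Fresh (flush M (runBody M
      (order.flatMap fun v => (nbrs v).map fun u => (v, u, w s(v, u)))
      (⟨fun _ => none, fun _ => 0⟩ : PMem V τ k))) :=
    ⟨fun p => by rw [hsame.1 _ (by simp) (by simp), hready.fresh.out],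
      by rw [hsame.2 _ (by simp) (by simp), hready.fresh.best]⟩
  obtain ⟨S, hS, hSi, hbest⟩ := search_spec ha hacc hval hfresh
  refine ⟨S, hS, hSi, fun O hO => ?_⟩
  generalize flush M (runBody M
    (order.flatMap fun v => (nbrs v).map fun u => (v, u, w s(v, u)))
    (⟨fun _ => none, fun _ => 0⟩ : PMem V τ k)) = m at *
  refine cov2_le_of_forall_mem_closure hE ha hτ
    (B := fun t => (level (fun p => m.vtx (0, p)) t).toFinset) ?_ ?_ ?_ hO
  · intro t t' htt
    rw [Finset.disjoint_left]
    intro x hx hx'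
    rw [Set.mem_toFinset] at hx hx'
    obtain ⟨j, hj⟩ := hx
    obtain ⟨j', hj'⟩ := hx'
    have := hval.inj _ _ _ hj hj'
    simp only [Option.some.injEq, Prod.mk.injEq] at this
    exact htt this.1
  · intro x hpos hx t
    simp only [Set.mem_toFinset] at hx ⊢
    rcases hsp x (by simp [hall]) hpos t (fun _ => t.2) with ⟨t', -, ht'⟩ | h
    · exact absurd ht' (hx t')
    · exact h
  · intro T hT hTi
    refine hbest T (fun x hx => ?_) hTi
    obtain ⟨t, -, hx⟩ := Finset.mem_biUnion.1 (hT hx)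
    rw [Set.mem_toFinset] at hx
    obtain ⟨j, hj⟩ := hx
    exact ⟨_, hj⟩

theorem program_isApproxSolution {ε : ℝ} (hτ : 0 < τ) (hτε : 2 ≤ τ * ε) (hε : 0 < ε) {s L : ℕ}
    (lay : Layout (VReg τ k) (WReg τ k) s L) (hL : ∀ ph, ((program τ k).code ph).length ≤ L)
    (hw : ∀ e ∈ G.edgeSet, 0 ≤ w e) (hE : M.E = Set.univ)
    (hk : M.eRank = (k : ℕ∞)) (hl : IsIncidenceStream G w l) :
    ∃ S : Set V, ((program τ k).alg lay).Outputs M l S ∧ IsApproxSolution G w M ε S := by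
  obtain ⟨S, hS, hSi, hbest⟩ := exists_output (τ := τ) hτ hw hE hk hl
  refine ⟨S, ?_, hSi, fun T hT => ?_⟩
  · rw [← hS]
    exact Program.outputs hL (computes_body M) (computes_final M) l
  · lift T to Finset V using Set.toFinite T
    have h := hbest T hT
    rw [← two_mul_coverWeight, ← two_mul_coverWeight] at h
    have h0 := coverWeight_nonneg hw (T : Set V)
    have hτ' : (0 : ℝ) < τ := by exact_mod_cast hτ
    -- From τε ≥ 2 follows (1 - ε)(τ + 2) ≤ τ.
    have h1 : (1 - ε) * (τ + 2) * coverWeight G w T ≤ τ * coverWeight G w T :=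
      mul_le_mul_of_nonneg_right (by linarith) h0
    refine le_of_mul_le_mul_left ?_ (by linarith : (0 : ℝ) < τ + 2)
    linarith

end Main

/-- For every matroid of rank `k`, a `(1 - ε)`-approximate solution can be computed in one pass
with `O((k / ε) ^ 2)` variables. -/
theorem exists_streamAlg (k : ℕ) {ε : ℝ} (hε : 0 < ε) :
    ∃ (s : ℕ) (P : StreamAlg s), (P.numVars : ℝ) ≤ 540 * ((k : ℝ) / ε) ^ 2 ∧
      ∀ (V : Type u) [Fintype V] [DecidableEq V] (G : SimpleGraph V) (w : Sym2 V → ℝ)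
        (M : Matroid V) (l : List (V × V × ℝ)),
        (∀ e ∈ G.edgeSet, 0 ≤ w e) → M.E = Set.univ → M.eRank = (k : ℕ∞) →
        IsIncidenceStream G w l →
        ∃ S : Set V, P.Outputs M l S ∧ IsApproxSolution G w M ε S := by
  -- For k = 0 no variable is allowed, and for large ε the bound may be below 1. In both cases the
  -- empty set is good enough and needs no variables.
  by_cases htriv : k = 0 ∨ 1 ≤ ε
  · refine ⟨0, ⟨Fin.elim0, fun _ => .output ∅⟩, ?_, ?_⟩
    · simp only [StreamAlg.numVars, Nat.cast_zero, add_zero]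
      positivity
    · intro V _ _ G w M l hw hE hk hl
      refine ⟨∅, ⟨0, ∅, rfl, by ext; simp [Config.stored]⟩, M.empty_indep, fun T hT => ?_⟩
      have h0 : coverWeight G w (∅ : Set V) = 0 := by simp [coverWeight]
      rcases htriv with rfl | h1
      · have : T = ∅ := by
          have := hT.encard_le_eRank
          rw [hk] at this
          simpa using this
        simp [this, h0]
      · rw [h0]
        exact mul_nonpos_of_nonpos_of_nonneg (by linarith) (coverWeight_nonneg hw T)
  · rw [not_or, not_le] at htriv
    obtain ⟨hk0, hε1⟩ := htriv
    have hkpos : 0 < k := Nat.pos_of_ne_zero hk0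
    set τ := ⌈2 / ε⌉₊ with hτdef
    have hτ : 0 < τ := Nat.ceil_pos.2 (by positivity)
    have hτ1 : 2 / ε ≤ τ := Nat.le_ceil _
    have hτ2 : (τ : ℝ) ≤ 3 / ε := by
      have h1 : (τ : ℝ) < 2 / ε + 1 := Nat.ceil_lt_add_one (by positivity)
      have h2 : 1 ≤ 1 / ε := by rw [le_div_iff₀ hε]; linarith
      have h3 : 3 / ε = 2 / ε + 1 / ε := by ring
      linarith
    obtain ⟨lay⟩ := exists_program_layout hτ hkpos
    refine ⟨_, (program τ k).alg lay, ?_, ?_⟩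
    -- Three kinds of 20(τk)² variables, with τ ≤ 3/ε, give the constant 3·20·9 = 540.
    · have h1 : (τ : ℝ) * k ≤ 3 * (k / ε) := by
        calc (τ : ℝ) * k ≤ 3 / ε * k := mul_le_mul_of_nonneg_right hτ2 (Nat.cast_nonneg k)
          _ = 3 * (k / ε) := by ring
      have h2 := pow_le_pow_left₀ (by positivity) h1 2
      simp only [StreamAlg.numVars, Nat.cast_add, Nat.cast_mul, Nat.cast_pow, Nat.cast_ofNat]
      linarith
    · intro V _ _ G w M l hw hE hk hl
      refine program_isApproxSolution hτ ((div_le_iff₀ hε).1 hτ1) hε lay ?_ hw hE hk hl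
      rintro (- | -)
      exacts [length_body_le, length_final_le]

end MVC

theorem mainTheorem7 :
    ∃ C : ℝ, 0 < C ∧ ∀ (k : ℕ) (ε : ℝ), 0 < ε →
      (∃ (s : ℕ) (P : MVC.StreamAlg s),
        (P.numVars : ℝ) ≤ C * ((k : ℝ) / ε) ^ 2 ∧
        ∀ (V : Type*) [Fintype V] [DecidableEq V] (G : SimpleGraph V) (w : Sym2 V → ℝ)
          (M : Matroid V) (l : List (V × V × ℝ)),
          (∀ e ∈ G.edgeSet, 0 ≤ w e) → M.E = Set.univ → M.eRank = (k : ℕ∞) →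
          (MVC.IsUniform M ∨ MVC.IsPartition M ∨ MVC.IsLaminar M) →
          MVC.IsIncidenceStream G w l →
          ∃ S : Set V, P.Outputs M l S ∧ MVC.IsApproxSolution G w M ε S) ∧
      (∃ (s : ℕ) (P : MVC.StreamAlg s),
        (P.numVars : ℝ) ≤ C * ((k : ℝ) / ε + (k : ℝ)) ^ 2 ∧
        ∀ (V : Type*) [Fintype V] [DecidableEq V] (G : SimpleGraph V) (w : Sym2 V → ℝ)
          (M : Matroid V) (l : List (V × V × ℝ)),
          (∀ e ∈ G.edgeSet, 0 ≤ w e) → M.E = Set.univ → M.eRank = (k : ℕ∞) →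
          MVC.IsTransversal M →
          MVC.IsIncidenceStream G w l →
          ∃ S : Set V, P.Outputs M l S ∧ MVC.IsApproxSolution G w M ε S) := by
  refine ⟨540, by norm_num, fun k ε hε => ⟨?_, ?_⟩⟩
  · obtain ⟨s, P, hs, hP⟩ := MVC.exists_streamAlg k hε
    exact ⟨s, P, hs, fun V _ _ G w M l hw hE hk _ hl => hP V G w M l hw hE hk hl⟩
  · obtain ⟨s, P, hs, hP⟩ := MVC.exists_streamAlg k hε
    refine ⟨s, P, hs.trans ?_, fun V _ _ G w M l hw hE hk _ hl => hP V G w M l hw hE hk hl⟩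
    have h1 : (0 : ℝ) ≤ k / ε := by positivity
    have h2 : (k : ℝ) / ε ≤ k / ε + k := le_add_of_nonneg_right (Nat.cast_nonneg k)
    exact mul_le_mul_of_nonneg_left (pow_le_pow_left₀ h1 h2 2) (by norm_num)
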